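/- Fix $d\ge 2$ and $\lambda>0$. Let $r$ be the radius of a ball of volume $1$ in $\mathbb{R}^d$, let $B_\ell(x)$ be the open ball of radius $\ell$ about $x$, and let $|A|$ be the Lebesgue measure of $A$. For $\Lambda\subset\mathbb{R}^d$ compact put $\Lambda_{\mathrm{Int}}=\{x\in\Lambda:\operatorname{dist}(x,\Lambda^c)\ge r\}$. A boundary condition on $\Lambda$ is a measurable set $\tau\subseteq\Lambda_{\mathrm{Int}}$. Let $\Omega_\Lambda^\tau$ be the set of finite subsets of $\Lambda_{\mathrm{Int}}\setminus\tau$ whose points have pairwise distances at least $2r$, and let $\mu_\Lambda^\tau$ be the law on $\Omega_\Lambda^\tau$ of the Poisson point process of intensity $\lambda$ on $\Lambda_{\mathrm{Int}}\setminus\tau$ conditioned on all pairwise distances being at least $2r$ (the hard sphere model on $\Lambda$ at fugacity $\lambda$ with boundary condition $\tau$). For $\Lambda'\subseteq\Lambda$ let $\|\mu-\nu\|_{\Lambda'}$ be the total variation distance between the images of $\mu$ and $\nu$ under $X\mapsto X\cap\Lambda'_{\mathrm{Int}}$. The hard sphere model on $\mathbb{R}^d$ exhibits strong spatial mixing if there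 are $\alpha,\beta>0$ such that for all compact $\Lambda'\subseteq\Lambda\subset\mathbb{R}^d$ and all boundary conditions $\tau,\tau'$ on $\Lambda$, $$\|\mu_\Lambda^\tau-\mu_\Lambda^{\tau'}\|_{\Lambda'}\le\beta\,|\Lambda'|\,\exp\bigl(-\alpha\operatorname{dist}(\tau\triangle\tau',\Lambda')\bigr).$$ The heat-bath dynamics with update radius $L>0$ on $\Omega_\Lambda^\tau$ is the Markov chain that in each step picks a point $x$ uniformly at random in $\Lambda_{\mathrm{Int}}^{(L)}=\{x\in\mathbb{R}^d:\operatorname{dist}(x,\Lambda_{\mathrm{Int}})\le L\}$ and, if $X$ is the current configuration, replaces $X\cap B_L(x)$ by a Poisson point process of intensity $\lambda$ on $\{z\in B_L(x)\cap(\Lambda_{\mathrm{Int}}\setminus\tau): |z-y|\ge 2r\text{ for all }y\in X\setminus B_L(x)\}$ conditioned on all pairwise distances being at least $2r$ (if $\Lambda_{\mathrm{Int}}=\emptyset$, the chain stays at the empty configuration). It has optimal temporal mixing if there are $b,c>0$ such that for every compact $\Lambda\subset\mathbb{R}^d$, every boundary condition $\tau$ on $\Lambda$, every $s>0$, and any two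 instances $(X_t)$ and $(Y_t)$ of the dynamics on $\Omega_\Lambda^\tau$ (with arbitrary initial laws), with $n=|\Lambda|$, the total variation distance between the laws of $X_{\lfloor sn\rfloor}$ and $Y_{\lfloor sn\rfloor}$ is at most $b\,n\,e^{-cs}$. If the hard sphere model on $\mathbb{R}^d$ exhibits strong spatial mixing at fugacity $\lambda$, then there is $L_0>0$ such that for every $L\ge L_0$ the heat-bath dynamics with update radius $L$ at fugacity $\lambda$ has optimal temporal mixing. -/

import Mathlib

open MeasureTheory ProbabilityTheory
open scoped ENNReal

noncomputable section

namespace HardSphere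

/-- Euclidean space `ℝ^d`. -/
abbrev Space (d : ℕ) : Type := EuclideanSpace ℝ (Fin d)

/-! ### Finite point configurations -/

/-- A finite set of points of `ℝ^d` (the centers of the spheres). -/
@[ext]
structure Config (d : ℕ) where
  /-- the points of the configuration -/
  centers : Finset (Space d)

open scoped Classical in
/-- The configuration of the points of a finite family. -/
def ofFamily {d : ℕ} {ι : Type} [Fintype ι] (v : ι → Space d) : Config d :=
  ⟨Finset.univ.image v⟩

/-- The usual σ-algebra on finite point configurations: a set of configurations is measurable when
for every `k` the set of `k`-tuples of points that enumerate one of its members is Borel in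
`(ℝ^d)^k`. -/
instance instMeasurableSpaceConfig (d : ℕ) : MeasurableSpace (Config d) :=
  ⨅ k : ℕ, MeasurableSpace.map (fun v : Fin k → Space d => ofFamily v) inferInstance

open scoped Classical in
/-- Retain only the points of `X` that lie in `A`. -/
def Config.restrict {d : ℕ} (A : Set (Space d)) (X : Config d) : Config d :=
  ⟨X.centers.filter (fun y => y ∈ A)⟩

open scoped Classical in
/-- The union of two configurations. -/
def Config.union {d : ℕ} (X Y : Config d) : Config d :=
  ⟨X.centers ∪ Y.centers⟩

/-! ### The hard sphere model -/

/-- The radius `r = r_d` of a ball of volume `1` in `ℝ^d`. -/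
def radius (d : ℕ) : ℝ :=
  ((volume (Metric.ball (0 : Space d) 1)).toReal⁻¹) ^ ((d : ℝ)⁻¹)

/-- `Λ_Int = {x ∈ Λ : dist(x, Λᶜ) ≥ r}`. -/
def innerRegion {d : ℕ} (Λ : Set (Space d)) : Set (Space d) :=
  {x | x ∈ Λ ∧ ENNReal.ofReal (radius d) ≤ Metric.infEDist x Λᶜ}

/-- A boundary condition on `Λ`: a measurable set `τ ⊆ Λ_Int` of forbidden locations. -/
def IsBoundary {d : ℕ} (Λ τ : Set (Space d)) : Prop :=
  MeasurableSet τ ∧ τ ⊆ innerRegion Λ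

/-- `Ω_Λ^τ`: the finite subsets of `Λ_Int \ τ` with pairwise distances at least `2 r`. -/
def configs {d : ℕ} (Λ τ : Set (Space d)) : Set (Config d) :=
  {X | (∀ x ∈ X.centers, x ∈ innerRegion Λ \ τ) ∧
    ∀ x ∈ X.centers, ∀ y ∈ X.centers, x ≠ y → 2 * radius d ≤ dist x y}

/-- The `k`-tuples of points of `A` with pairwise distances at least `2 r`. -/
def packings {d : ℕ} (k : ℕ) (A : Set (Space d)) : Set (Fin k → Space d) :=
  {v | (∀ i, v i ∈ A) ∧ ∀ i j, i ≠ j → 2 * radius d ≤ dist (v i) (v j)}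

/-- The partition function
`∑_k λ^k / k! ∫_{A^k} ∏_{i<j} 1[‖x_i - x_j‖ ≥ 2 r] dx_1 ⋯ dx_k` of hard spheres with centers
in `A`. -/
def partitionFunction {d : ℕ} (lam : ℝ) (A : Set (Space d)) : ℝ≥0∞ :=
  ∑' k : ℕ, ENNReal.ofReal (lam ^ k / (k.factorial : ℝ)) * volume (packings k A)

/-- The law of hard spheres with centers in `A` at fugacity `lam`, that is, the Poisson point
process of intensity `lam` on `A` conditioned on all pairwise distances being at least `2 r`:
on `k`-point configurations it has density `λ^k / k! ∏_{i<j} 1[‖x_i - x_j‖ ≥ 2 r]` on `A^k`,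
divided by the partition function. -/
def hardLaw {d : ℕ} (lam : ℝ) (A : Set (Space d)) : Measure (Config d) :=
  (partitionFunction lam A)⁻¹ • Measure.sum fun k : ℕ =>
    ENNReal.ofReal (lam ^ k / (k.factorial : ℝ)) •
      (volume.restrict (packings k A)).map (fun v : Fin k → Space d => ofFamily v)

/-- The hard sphere model `μ_Λ^τ` on `Λ` with boundary condition `τ`. -/
def gibbs {d : ℕ} (lam : ℝ) (Λ τ : Set (Space d)) : Measure (Config d) :=
  hardLaw lam (innerRegion Λ \ τ)

/-! ### Strong spatial mixing -/

/-- Total variation distance: the supremum over all events of the difference of the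
probabilities. -/
def tvDist {S : Type} [MeasurableSpace S] (μ ν : Measure S) : ℝ :=
  ⨆ A : {A : Set S // MeasurableSet A}, |μ.real A - ν.real A|

/-- `‖μ - ν‖_Λ'`: the total variation distance of the images of `μ` and `ν` under the projection
to configurations of spheres contained in `Λ'`. -/
def tvDistOn {d : ℕ} (Λ' : Set (Space d)) (μ ν : Measure (Config d)) : ℝ :=
  tvDist (μ.map (Config.restrict (innerRegion Λ'))) (ν.map (Config.restrict (innerRegion Λ')))

/-- The distance between two sets, `∞` if one of them is empty. -/
def setDist {d : ℕ} (A B : Set (Space d)) : ℝ≥0∞ :=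
  ⨅ x ∈ A, Metric.infEDist x B

/-- Strong spatial mixing on `ℝ^d` at fugacity `lam`. (If the distance is infinite, then `τ = τ'`
or `Λ'` is empty, and the left-hand side is `0`.) -/
def StrongSpatialMixing (d : ℕ) (lam : ℝ) : Prop :=
  ∃ α > (0 : ℝ), ∃ β > (0 : ℝ), ∀ Λ' Λ : Set (Space d), IsCompact Λ' → IsCompact Λ → Λ' ⊆ Λ →
    ∀ τ τ' : Set (Space d), IsBoundary Λ τ → IsBoundary Λ τ' →
      tvDistOn Λ' (gibbs lam Λ τ) (gibbs lam Λ τ') ≤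
        β * (volume Λ').toReal * Real.exp (-(α * (setDist (symmDiff τ τ') Λ').toReal))

/-! ### The heat-bath dynamics -/

/-- The locations in the open ball `B_L(x)` that are available when the centers of `X` in that ball
are resampled: those in `Λ_Int \ τ` at distance at least `2 r` from every center of `X` outside
the ball. -/
def available {d : ℕ} (Λ τ : Set (Space d)) (L : ℝ) (X : Config d) (x : Space d) :
    Set (Space d) :=
  {z | z ∈ innerRegion Λ \ τ ∧ z ∈ Metric.ball x L ∧
    ∀ y ∈ X.centers, y ∉ Metric.ball x L → 2 * radius d ≤ dist z y}

/-- The law of the configuration obtained from `X` by resampling the centers in `B_L(x)` according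
to the hard sphere model, given the other centers of `X` and the boundary condition `τ`. -/
def resample {d : ℕ} (lam : ℝ) (Λ τ : Set (Space d)) (L : ℝ) (X : Config d) (x : Space d) :
    Measure (Config d) :=
  (hardLaw lam (available Λ τ L X x)).map
    (fun Z => (X.restrict (Metric.ball x L)ᶜ).union Z)

/-- The law of the configuration after one update of `X`: the center `x` of the update ball is
uniform in the parallel set `Λ_Int^{(L)}`, and then `B_L(x)` is resampled. -/
def heatBathStep {d : ℕ} (lam : ℝ) (Λ τ : Set (Space d)) (L : ℝ) (X : Config d) :
    Measure (Config d) :=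
  (ProbabilityTheory.cond volume (Metric.cthickening L (innerRegion Λ))).bind (resample lam Λ τ L X)

/-! #### The update is a transition kernel -/

theorem measurable_of_tuples {d : ℕ} {β : Type*} [MeasurableSpace β] {f : Config d → β}
    (h : ∀ k : ℕ, Measurable fun v : Fin k → Space d => f (ofFamily v)) : Measurable f := by
  intro s hs
  refine MeasurableSpace.measurableSet_iInf.2 fun k => ?_
  exact h k hs

theorem measurable_ofTuple {d : ℕ} (k : ℕ) :
    Measurable fun v : Fin k → Space d => ofFamily v := by
  intro s hs
  exact MeasurableSpace.measurableSet_iInf.1 hs k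

theorem measurable_ofFamily {d : ℕ} {ι : Type} [Fintype ι] :
    Measurable fun v : ι → Space d => ofFamily v := by
  classical
  have e := (Fintype.equivFin ι).symm
  have h : (fun v : ι → Space d => ofFamily v) =
      (fun w : Fin (Fintype.card ι) → Space d => ofFamily w) ∘ fun v i => v (e i) := by
    funext v
    ext y
    simp only [ofFamily, Function.comp, Finset.mem_image, Finset.mem_univ, true_and]
    exact (e.exists_congr_right (q := fun a => v a = y)).symm
  rw [h]
  exact (measurable_ofTuple _).comp (measurable_pi_lambda _ fun i => measurable_pi_apply _)

open scoped Classical in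
theorem measurable_selection {d : ℕ} {α ι : Type} [MeasurableSpace α] [Fintype ι]
    {g : ι → α → Space d} (hg : ∀ i, Measurable (g i)) {P : ι → Set α}
    (hP : ∀ i, MeasurableSet (P i)) :
    Measurable fun a => (⟨(Finset.univ.filter fun i => a ∈ P i).image fun i => g i a⟩ :
      Config d) := by
  intro s hs
  have h : (fun a => (⟨(Finset.univ.filter fun i => a ∈ P i).image fun i => g i a⟩ :
      Config d)) ⁻¹' s = ⋃ J : Finset ι, (⋂ i : ι, {a | a ∈ P i ↔ i ∈ J}) ∩
        (fun a => ofFamily fun j : J => g j a) ⁻¹' s := by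
    ext a
    have key : ∀ J : Finset ι, (ofFamily fun j : J => g j a) = ⟨J.image fun i => g i a⟩ := by
      intro J
      ext y
      simp [ofFamily]
    simp only [Set.mem_preimage, Set.mem_iUnion, Set.mem_inter_iff, Set.mem_iInter,
      Set.mem_ofPred_eq, key]
    constructor
    · intro ha
      exact ⟨Finset.univ.filter fun i => a ∈ P i, by simp, ha⟩
    · rintro ⟨J, hJ, ha⟩
      have : (Finset.univ.filter fun i => a ∈ P i) = J := by
        ext i
        simp [hJ i]
      rwa [this]
  rw [h]
  refine MeasurableSet.iUnion fun J => (MeasurableSet.iInter fun i => ?_).inter ?_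
  · by_cases hi : i ∈ J
    · have h1 : {a | a ∈ P i ↔ i ∈ J} = P i := by ext a; simp [hi]
      rw [h1]
      exact hP i
    · have h1 : {a | a ∈ P i ↔ i ∈ J} = (P i)ᶜ := by ext a; simp [hi]
      rw [h1]
      exact (hP i).compl
  · have h1 : Measurable fun a => fun j : J => g j a := measurable_pi_lambda _ fun j => hg j
    exact (measurable_ofFamily.comp h1) hs

theorem measurable_restrict {d : ℕ} {A : Set (Space d)} (hA : MeasurableSet A) :
    Measurable (Config.restrict A) := by
  classical
  refine measurable_of_tuples fun k => ?_
  have h := measurable_selection (d := d) (α := Fin k → Space d) (ι := Fin k)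
    (g := fun i v => v i) (fun i => measurable_pi_apply i)
    (P := fun i => {v | v i ∈ A}) (fun i => measurable_pi_apply i hA)
  convert h using 2 with v
  ext y
  simp only [Config.restrict, ofFamily, Finset.mem_filter, Finset.mem_image, Finset.mem_univ,
    true_and, Set.mem_ofPred_eq]
  constructor
  · rintro ⟨⟨i, rfl⟩, hy⟩
    exact ⟨i, hy, rfl⟩
  · rintro ⟨i, hi, rfl⟩
    exact ⟨⟨i, rfl⟩, hi⟩

theorem measurable_union_ofFamily {d m k : ℕ} (L : ℝ) :
    Measurable fun p : ((Fin m → Space d) × Space d) × (Fin k → Space d) =>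
      ((ofFamily p.1.1).restrict (Metric.ball p.1.2 L)ᶜ).union (ofFamily p.2) := by
  classical
  have h := measurable_selection (d := d)
    (α := ((Fin m → Space d) × Space d) × (Fin k → Space d)) (ι := Fin m ⊕ Fin k)
    (g := Sum.elim (fun i p => p.1.1 i) (fun j p => p.2 j))
    (by rintro (i | j) <;> simp only [Sum.elim_inl, Sum.elim_inr] <;> fun_prop)
    (P := Sum.elim (fun i => {p | L ≤ dist (p.1.1 i) p.1.2}) (fun _ => Set.univ))
    (by
      rintro (i | j)
      · simp only [Sum.elim_inl]
        exact measurableSet_le measurable_const (by fun_prop)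
      · simp)
  convert h using 2 with p
  ext y
  simp only [Config.union, Config.restrict, ofFamily, Finset.mem_union, Finset.mem_filter,
    Finset.mem_image, Finset.mem_univ, true_and, Sum.exists, Sum.elim_inl, Sum.elim_inr,
    Set.mem_univ, Set.mem_ofPred_eq, Set.mem_compl_iff, Metric.mem_ball, not_lt]
  constructor
  · rintro (⟨⟨i, rfl⟩, hi⟩ | ⟨j, rfl⟩)
    · exact Or.inl ⟨i, hi, rfl⟩
    · exact Or.inr ⟨j, rfl⟩
  · rintro (⟨i, hi, rfl⟩ | ⟨j, rfl⟩)
    · exact Or.inl ⟨⟨i, rfl⟩, hi⟩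
    · exact Or.inr ⟨j, rfl⟩

theorem measurable_union {d : ℕ} (Y : Config d) : Measurable (Config.union Y) := by
  classical
  refine measurable_of_tuples fun k => ?_
  have h := measurable_selection (d := d) (α := Fin k → Space d) (ι := Y.centers ⊕ Fin k)
    (g := Sum.elim (fun i _ => i.1) (fun j p => p j))
    (by rintro (i | j) <;> simp only [Sum.elim_inl, Sum.elim_inr] <;> fun_prop)
    (P := fun _ => Set.univ) (fun _ => MeasurableSet.univ)
  convert h using 2 with p
  ext y
  simp [Config.union, ofFamily]

theorem measurableSet_innerRegion {d : ℕ} {Λ : Set (Space d)} (hΛ : MeasurableSet Λ) :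
    MeasurableSet (innerRegion Λ) :=
  hΛ.inter (measurableSet_le measurable_const Metric.continuous_infEDist.measurable)

theorem measurableSet_packings_available {d m k : ℕ} {Λ τ : Set (Space d)}
    (hΛ : MeasurableSet Λ) (hτ : MeasurableSet τ) (L : ℝ) :
    MeasurableSet {p : ((Fin m → Space d) × Space d) × (Fin k → Space d) |
      p.2 ∈ packings k (available Λ τ L (ofFamily p.1.1) p.1.2)} := by
  classical
  have h : {p : ((Fin m → Space d) × Space d) × (Fin k → Space d) |
      p.2 ∈ packings k (available Λ τ L (ofFamily p.1.1) p.1.2)} =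
      (⋂ i : Fin k, {p | p.2 i ∈ innerRegion Λ \ τ} ∩ ({p | dist (p.2 i) p.1.2 < L} ∩
        ⋂ j : Fin m, ({p | dist (p.1.1 j) p.1.2 < L} ∪
          {p | 2 * radius d ≤ dist (p.2 i) (p.1.1 j)}))) ∩
      ⋂ i : Fin k, ⋂ j : Fin k, ({_p | i = j} ∪ {p | 2 * radius d ≤ dist (p.2 i) (p.2 j)}) := by
    ext p
    simp only [packings, available, ofFamily, Metric.mem_ball, Set.mem_ofPred_eq, Set.mem_inter_iff,
      Set.mem_iInter, Set.mem_union, Finset.mem_image, Finset.mem_univ, true_and,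
      forall_exists_index, forall_apply_eq_imp_iff, ne_eq, or_iff_not_imp_left]
  rw [h]
  refine MeasurableSet.inter (MeasurableSet.iInter fun i => MeasurableSet.inter ?_
    (MeasurableSet.inter ?_ (MeasurableSet.iInter fun j => MeasurableSet.union ?_ ?_)))
    (MeasurableSet.iInter fun i => MeasurableSet.iInter fun j => MeasurableSet.union ?_ ?_)
  · exact (show Measurable fun p : ((Fin m → Space d) × Space d) × (Fin k → Space d) => p.2 i by
      fun_prop) ((measurableSet_innerRegion hΛ).diff hτ)
  · exact measurableSet_lt (by fun_prop) measurable_const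
  · exact measurableSet_lt (by fun_prop) measurable_const
  · exact measurableSet_le measurable_const (by fun_prop)
  · exact MeasurableSet.const _
  · exact measurableSet_le measurable_const (by fun_prop)

theorem measurable_resample_ofFamily {d m : ℕ} (lam : ℝ) {Λ τ : Set (Space d)}
    (hΛ : MeasurableSet Λ) (hτ : MeasurableSet τ) (L : ℝ) :
    Measurable fun p : (Fin m → Space d) × Space d =>
      resample lam Λ τ L (ofFamily p.1) p.2 := by
  refine Measure.measurable_of_measurable_coe _ fun S hS => ?_
  have hpack := fun k => measurableSet_packings_available (m := m) (k := k) hΛ hτ L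
  have hEv : ∀ k : ℕ, MeasurableSet
      {p : ((Fin m → Space d) × Space d) × (Fin k → Space d) |
        ((ofFamily p.1.1).restrict (Metric.ball p.1.2 L)ᶜ).union (ofFamily p.2) ∈ S} :=
    fun k => measurable_union_ofFamily L hS
  have h : (fun p : (Fin m → Space d) × Space d =>
      resample lam Λ τ L (ofFamily p.1) p.2 S) = fun p =>
      (∑' k : ℕ, ENNReal.ofReal (lam ^ k / (k.factorial : ℝ)) * volume (Prod.mk p ⁻¹'
        {q : ((Fin m → Space d) × Space d) × (Fin k → Space d) |
          q.2 ∈ packings k (available Λ τ L (ofFamily q.1.1) q.1.2)}))⁻¹ *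
      ∑' k : ℕ, ENNReal.ofReal (lam ^ k / (k.factorial : ℝ)) * volume (Prod.mk p ⁻¹'
        ({q : ((Fin m → Space d) × Space d) × (Fin k → Space d) |
          ((ofFamily q.1.1).restrict (Metric.ball q.1.2 L)ᶜ).union (ofFamily q.2) ∈ S} ∩
        {q : ((Fin m → Space d) × Space d) × (Fin k → Space d) |
          q.2 ∈ packings k (available Λ τ L (ofFamily q.1.1) q.1.2)})) := by
    funext p
    have hu := measurable_union ((ofFamily p.1).restrict (Metric.ball p.2 L)ᶜ)
    rw [resample, Measure.map_apply hu hS, hardLaw, Measure.smul_apply,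
      Measure.sum_apply _ (hu hS), smul_eq_mul]
    congr 1
    refine tsum_congr fun k => ?_
    rw [Measure.smul_apply, Measure.map_apply (measurable_ofTuple k) (hu hS),
      Measure.restrict_apply (measurable_ofTuple k (hu hS)), smul_eq_mul]
    rfl
  rw [h]
  refine Measurable.mul (Measurable.inv (Measurable.tsum fun k => ?_))
    (Measurable.tsum fun k => ?_)
  · exact (measurable_measure_prodMk_left (hpack k)).const_mul _
  · exact (measurable_measure_prodMk_left ((hEv k).inter (hpack k))).const_mul _

theorem exists_ofFamily {d : ℕ} (X : Config d) :
    ∃ (k : ℕ) (v : Fin k → Space d), ofFamily v = X := by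
  refine ⟨X.centers.card, fun i => (X.centers.equivFin.symm i).1, ?_⟩
  ext y
  simp only [ofFamily, Finset.mem_image, Finset.mem_univ, true_and]
  constructor
  · rintro ⟨i, rfl⟩
    exact (X.centers.equivFin.symm i).2
  · intro hy
    exact ⟨X.centers.equivFin ⟨y, hy⟩, by simp⟩

theorem measurable_resample {d : ℕ} (lam : ℝ) {Λ τ : Set (Space d)}
    (hΛ : MeasurableSet Λ) (hτ : MeasurableSet τ) (L : ℝ) (X : Config d) :
    Measurable (resample lam Λ τ L X) := by
  obtain ⟨k, v, hv⟩ := exists_ofFamily X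
  have h := measurable_resample_ofFamily (m := k) lam hΛ hτ L
  have h1 : Measurable fun x : Space d => (v, x) := measurable_prodMk_left
  have h2 := h.comp h1
  simp only [Function.comp_def, hv] at h2
  exact h2

theorem measurable_heatBathStep {d : ℕ} (lam : ℝ) {Λ τ : Set (Space d)}
    (hΛ : MeasurableSet Λ) (hτ : MeasurableSet τ) (L : ℝ) :
    Measurable (heatBathStep lam Λ τ L) := by
  refine Measure.measurable_of_measurable_coe _ fun S hS => measurable_of_tuples fun k => ?_
  have h : (fun v : Fin k → Space d => heatBathStep lam Λ τ L (ofFamily v) S) = fun v =>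
      ∫⁻ x, resample lam Λ τ L (ofFamily v) x S
        ∂(ProbabilityTheory.cond volume (Metric.cthickening L (innerRegion Λ))) := by
    funext v
    exact Measure.bind_apply hS (measurable_resample lam hΛ hτ L _).aemeasurable
  rw [h]
  exact Measurable.lintegral_prod_right'
    (f := fun p : (Fin k → Space d) × Space d => resample lam Λ τ L (ofFamily p.1) p.2 S)
    ((Measure.measurable_coe hS).comp (measurable_resample_ofFamily lam hΛ hτ L))

open scoped Classical in
/-- The transition kernel of the heat-bath dynamics with update radius `L`. If `Λ_Int` is empty,
then the empty configuration is the only state and there is nothing to update: the chain stays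
where it is. -/
def heatBath {d : ℕ} (lam : ℝ) {Λ τ : Set (Space d)} (hΛ : MeasurableSet Λ)
    (hτ : MeasurableSet τ) (L : ℝ) : Kernel (Config d) (Config d) :=
  if (innerRegion Λ).Nonempty then ⟨heatBathStep lam Λ τ L, measurable_heatBathStep lam hΛ hτ L⟩
  else Kernel.id

/-- The law after `t` steps of the heat-bath dynamics started from the law `p`. -/
def lawAfter {d : ℕ} (lam : ℝ) {Λ τ : Set (Space d)} (hΛ : MeasurableSet Λ)
    (hτ : MeasurableSet τ) (L : ℝ) (p : Measure (Config d)) (t : ℕ) : Measure (Config d) :=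
  p.bind (heatBath lam hΛ hτ L ^ t : Kernel (Config d) (Config d))

/-- Optimal temporal mixing of the heat-bath dynamics with update radius `L`: with `n = |Λ|`,
two instances of the chain on `Ω_Λ^τ`, started from any initial laws `p` and `q` on `Ω_Λ^τ`, are
within total variation distance `b n e^{-c s}` after `⌊s n⌋` steps. -/
def OptimalTemporalMixing (d : ℕ) (lam L : ℝ) : Prop :=
  ∃ b > (0 : ℝ), ∃ c > (0 : ℝ), ∀ (Λ τ : Set (Space d)) (hΛ : IsCompact Λ)
    (hτ : IsBoundary Λ τ) (s : ℝ), 0 < s →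
    ∀ p q : Measure (Config d), IsProbabilityMeasure p → IsProbabilityMeasure q →
      (∀ᵐ X ∂p, X ∈ configs Λ τ) → (∀ᵐ X ∂q, X ∈ configs Λ τ) →
      tvDist (lawAfter lam hΛ.measurableSet hτ.1 L p ⌊s * (volume Λ).toReal⌋₊)
          (lawAfter lam hΛ.measurableSet hτ.1 L q ⌊s * (volume Λ).toReal⌋₊) ≤
        b * (volume Λ).toReal * Real.exp (-(c * s))

end HardSphere

end

noncomputable section

namespace HardSphere

/-! ### Volumes and packings -/

/-! The argument is path coupling in dual form: no coupling is built, and the transition operator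
acts on observables instead. Let `l` bound the change of an observable `f` when one sphere is added
to a configuration (`LipOn`). The aim is that one step of the dynamics turns `l` into `(1 - 1/V) l`,
where `V` is the volume of the set of possible update centers.

Compare updates at `x` started from `X` and from `X ∪ {v}`. If `v ∈ B_L(x)`, then `v` is erased and
both laws agree. If `v` is at distance at least `L + 2r` from `x`, then `v` survives but does not
affect the resampling, at cost `l`. In the shell between, `v` survives and the two available regions
differ inside `B_{2r}(v)`. There the centers near `v` are few by a volume count, and strong spatial
mixing makes the centers farther than about `R` from `v` nearly equal in law, at total cost `(1 +
spread) l` (`LipOn.lintegral_hardLaw_shell`). Averaging over `x`, the factor is at most `1 - (|B_L|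
- spread · |shell|) / V` (`lintegral_influence_le`). Since `|shell| / |B_L|` is of order `1 / L`,
while a suitable `R` keeps `spread` much smaller than `L`, the bracket is at least `1` for all large
`L` (`exists_updateRadius`).

An indicator has `l ≤ 1`, so after `t` steps the increment is at most `(1 - 1/V)^t`
(`lipOn_heatBath_pow`). Every configuration arises from the empty one by adding at most `|Λ|`
spheres, so the probabilities of an event from two starting laws differ by at most `2 |Λ| (1 -
1/V)^t` (`LipOn.lintegral_le`). As `V` is at most a constant times `|Λ|`
(`volume_cthickening_innerRegion_le`), this is the required decay. -/

theorem volume_unitBall_ne {d : ℕ} :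
    0 < (volume (Metric.ball (0 : Space d) 1)).toReal :=
  ENNReal.toReal_pos (Metric.measure_ball_pos volume _ one_pos).ne' measure_ball_lt_top.ne

theorem radius_pos (d : ℕ) : 0 < radius d :=
  Real.rpow_pos_of_pos (inv_pos.2 volume_unitBall_ne) _

theorem volume_ball {d : ℕ} (hd : 0 < d) (x : Space d) {ρ : ℝ} (hρ : 0 ≤ ρ) :
    volume (Metric.ball x ρ) = ENNReal.ofReal ((ρ / radius d) ^ d) := by
  have : Nonempty (Fin d) := ⟨⟨0, hd⟩⟩
  have hw := volume_unitBall_ne (d := d)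
  have hr : radius d ^ d = (volume (Metric.ball (0 : Space d) 1)).toReal⁻¹ :=
    Real.rpow_inv_natCast_pow (inv_pos.2 hw).le hd.ne'
  rw [Measure.addHaar_ball volume x hρ, finrank_euclideanSpace_fin, div_pow, hr, div_inv_eq_mul,
    ENNReal.ofReal_mul (by positivity), ENNReal.ofReal_toReal measure_ball_lt_top.ne]

theorem volume_ball_radius {d : ℕ} (hd : 0 < d) (x : Space d) :
    volume (Metric.ball x (radius d)) = 1 := by
  rw [volume_ball hd x (radius_pos d).le, div_self (radius_pos d).ne', one_pow,
    ENNReal.ofReal_one]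

/-- The points of `s` have pairwise distances at least `2 r`. -/
def Separated {d : ℕ} (s : Finset (Space d)) : Prop :=
  ∀ x ∈ s, ∀ y ∈ s, x ≠ y → 2 * radius d ≤ dist x y

theorem Separated.mono {d : ℕ} {s t : Finset (Space d)} (ht : Separated t) (h : s ⊆ t) :
    Separated s := fun x hx y hy => ht x (h hx) y (h hy)

/-- The balls of radius `r` about the points are disjoint and have volume exactly `1`, so counting
points is measuring volume. -/
theorem Separated.card_le_volume {d : ℕ} (hd : 0 < d) {s : Finset (Space d)} (hs : Separated s)
    {U : Set (Space d)} (hU : ∀ z ∈ s, Metric.ball z (radius d) ⊆ U) :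
    (s.card : ℝ≥0∞) ≤ volume U := by
  have h1 : volume (⋃ z ∈ s, Metric.ball z (radius d)) = s.card := by
    rw [measure_biUnion_finset]
    · simp [volume_ball_radius hd]
    · intro x hx y hy hxy
      exact Metric.ball_disjoint_ball (by linarith [hs x hx y hy hxy])
    · exact fun _ _ => Metric.isOpen_ball.measurableSet
  rw [← h1]
  exact measure_mono (Set.iUnion₂_subset hU)

theorem Separated.card_le_of_ball {d : ℕ} (hd : 0 < d) {s : Finset (Space d)} (hs : Separated s)
    {c : Space d} {ρ : ℝ} (hρ : 0 ≤ ρ) (h : ∀ z ∈ s, z ∈ Metric.ball c ρ) :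
    (s.card : ℝ≥0∞) ≤ ENNReal.ofReal (((ρ + radius d) / radius d) ^ d) := by
  rw [← volume_ball hd c (add_nonneg hρ (radius_pos d).le)]
  refine hs.card_le_volume hd fun z hz => Metric.ball_subset_ball' ?_
  have := Metric.mem_ball.1 (h z hz)
  linarith

theorem mem_innerRegion {d : ℕ} {Λ : Set (Space d)} {z : Space d} :
    z ∈ innerRegion Λ ↔ Metric.ball z (radius d) ⊆ Λ := by
  have hr := radius_pos d
  constructor
  · rintro ⟨_, h⟩ y hy
    by_contra hyΛ
    have h1 := h.trans (Metric.infEDist_le_edist_of_mem (show y ∈ Λᶜ from hyΛ))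
    rw [edist_dist, ENNReal.ofReal_le_ofReal_iff dist_nonneg] at h1
    rw [Metric.mem_ball, dist_comm] at hy
    linarith
  · intro h
    refine ⟨h (Metric.mem_ball_self hr), Metric.le_infEDist.2 fun y hy => ?_⟩
    rw [edist_dist]
    refine ENNReal.ofReal_le_ofReal ?_
    by_contra! h1
    exact hy (h (by rwa [Metric.mem_ball, dist_comm]))

theorem innerRegion_subset {d : ℕ} (Λ : Set (Space d)) : innerRegion Λ ⊆ Λ := fun _ h => h.1

/-- A packing of `Λ_Int` of largest cardinality has at most `|Λ|` points, and by maximality the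
balls of radius `2r` about them cover `Λ_Int`; enlarging them covers the parallel set. This turns a
gain of `1/V` per step into one of order `1/|Λ|`, uniformly in the shape of `Λ`. -/
theorem volume_cthickening_innerRegion_le {d : ℕ} (hd : 0 < d) {Λ : Set (Space d)}
    (hΛ : IsCompact Λ) {L : ℝ} (hL : 0 < L) :
    volume (Metric.cthickening L (innerRegion Λ)) ≤
      volume Λ * ENNReal.ofReal (((L + 3 * radius d) / radius d) ^ d) := by
  classical
  have hr := radius_pos d
  have hfin : volume Λ ≠ ∞ := hΛ.measure_lt_top.ne
  let S : Set ℕ := {k | ∃ s : Finset (Space d), (∀ x ∈ s, x ∈ innerRegion Λ) ∧ Separated s ∧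
    s.card = k}
  have hbd : ∀ s : Finset (Space d), (∀ x ∈ s, x ∈ innerRegion Λ) → Separated s →
      (s.card : ℝ≥0∞) ≤ volume Λ := fun s h1 h2 =>
    h2.card_le_volume hd fun z hz => mem_innerRegion.1 (h1 z hz)
  have hS : BddAbove S := by
    refine ⟨⌊(volume Λ).toReal⌋₊, ?_⟩
    rintro k ⟨s, h1, h2, rfl⟩
    refine Nat.le_floor ?_
    have := ENNReal.toReal_mono hfin (hbd s h1 h2)
    simpa using this
  have hne : S.Nonempty := ⟨0, ∅, by simp, by simp [Separated], by simp⟩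
  obtain ⟨s, h1, h2, h3⟩ := Nat.sSup_mem hne hS
  have hcov : ∀ x ∈ innerRegion Λ, ∃ y ∈ s, dist x y < 2 * radius d := by
    intro x hx
    by_contra! hfar
    have hxs : x ∉ s := fun hxs => by
      have := hfar x hxs
      rw [dist_self] at this
      linarith
    have hmem : s.card + 1 ∈ S := by
      refine ⟨insert x s, ?_, ?_, Finset.card_insert_of_notMem hxs⟩
      · intro y hy
        rcases Finset.mem_insert.1 hy with rfl | hy
        exacts [hx, h1 y hy]
      · intro y hy z hz hyz
        rcases Finset.mem_insert.1 hy with hy' | hy' <;>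
          rcases Finset.mem_insert.1 hz with hz' | hz'
        · exact absurd (hy'.trans hz'.symm) hyz
        · rw [hy']; exact hfar z hz'
        · rw [hz', dist_comm]; exact hfar y hy'
        · exact h2 y hy' z hz' hyz
    have := le_csSup hS hmem
    omega
  have hsub : Metric.cthickening L (innerRegion Λ) ⊆
      ⋃ y ∈ s, Metric.ball y (L + 3 * radius d) := by
    intro x hx
    -- The set need not be closed, so distance `L` need not be attained; a slack of `r` is spent
    -- here, whence `L + r + 2r = L + 3r`.
    obtain ⟨z, hz, hxz⟩ := Set.mem_iUnion₂.1
      (Metric.cthickening_subset_iUnion_closedBall_of_lt (innerRegion Λ) (δ := L)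
        (δ' := L + radius d) (by positivity) (by linarith) hx)
    obtain ⟨y, hy, hzy⟩ := hcov z hz
    refine Set.mem_iUnion₂.2 ⟨y, hy, ?_⟩
    rw [Metric.mem_closedBall] at hxz
    rw [Metric.mem_ball]
    linarith [dist_triangle x z y]
  calc volume (Metric.cthickening L (innerRegion Λ))
      ≤ ∑ y ∈ s, volume (Metric.ball y (L + 3 * radius d)) :=
        (measure_mono hsub).trans (measure_biUnion_finset_le _ _)
    _ = s.card * ENNReal.ofReal (((L + 3 * radius d) / radius d) ^ d) := by
        rw [Finset.sum_congr rfl fun y _ => volume_ball hd y (by positivity)]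
        simp
    _ ≤ _ := by gcongr; exact hbd s h1 h2

/-! ### Admissible configurations and their law -/

/-- The configurations with centers in `A` at pairwise distances at least `2 r`. -/
def admissible {d : ℕ} (A : Set (Space d)) : Set (Config d) :=
  {X | (∀ x ∈ X.centers, x ∈ A) ∧ Separated X.centers}

theorem configs_eq {d : ℕ} (Λ τ : Set (Space d)) :
    configs Λ τ = admissible (innerRegion Λ \ τ) := rfl

theorem measurableSet_admissible {d : ℕ} {A : Set (Space d)} (hA : MeasurableSet A) :
    MeasurableSet (admissible A) := by
  classical
  refine MeasurableSpace.measurableSet_iInf.2 fun k => ?_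
  change MeasurableSet ((fun v : Fin k → Space d => ofFamily v) ⁻¹' admissible A)
  have h : (fun v : Fin k → Space d => ofFamily v) ⁻¹' admissible A =
      (⋂ i : Fin k, (fun v => v i) ⁻¹' A) ∩
      ⋂ i : Fin k, ⋂ j : Fin k, {v | v i = v j} ∪ {v | 2 * radius d ≤ dist (v i) (v j)} := by
    ext v
    simp only [admissible, Separated, ofFamily, Set.mem_preimage, Set.mem_ofPred_eq,
      Finset.mem_image, Finset.mem_univ, true_and, forall_exists_index, forall_apply_eq_imp_iff,
      Set.mem_inter_iff, Set.mem_iInter, Set.mem_union, ne_eq, or_iff_not_imp_left]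
  rw [h]
  refine (MeasurableSet.iInter fun i => measurable_pi_apply i hA).inter
    (MeasurableSet.iInter fun i => MeasurableSet.iInter fun j => MeasurableSet.union ?_ ?_)
  · exact measurableSet_eq_fun (measurable_pi_apply i) (measurable_pi_apply j)
  · exact measurableSet_le measurable_const (by fun_prop)

theorem measurableSet_packings {d k : ℕ} {A : Set (Space d)} (hA : MeasurableSet A) :
    MeasurableSet (packings k A) := by
  have h : packings k A = (⋂ i : Fin k, (fun v => v i) ⁻¹' A) ∩
      ⋂ i : Fin k, ⋂ j : Fin k, {_v | i = j} ∪ {v | 2 * radius d ≤ dist (v i) (v j)} := by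
    ext v
    simp only [packings, Set.mem_ofPred_eq, Set.mem_inter_iff, Set.mem_iInter, Set.mem_union,
      Set.mem_preimage, ne_eq, or_iff_not_imp_left]
  rw [h]
  refine (MeasurableSet.iInter fun i => measurable_pi_apply i hA).inter
    (MeasurableSet.iInter fun i => MeasurableSet.iInter fun j => MeasurableSet.union ?_ ?_)
  · exact MeasurableSet.const _
  · exact measurableSet_le measurable_const (by fun_prop)

theorem partitionFunction_ne_zero {d : ℕ} (lam : ℝ) (A : Set (Space d)) :
    partitionFunction lam A ≠ 0 := by
  intro h
  have h0 := ENNReal.tsum_eq_zero.1 h 0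
  have h1 : packings 0 A = Set.univ := Set.eq_univ_of_forall fun v =>
    ⟨fun i => i.elim0, fun i => i.elim0⟩
  have h2 : (volume : Measure (Fin 0 → Space d)) Set.univ = 1 := by
    rw [← Set.pi_univ Set.univ, volume_pi, Measure.pi_pi]
    simp
  rw [h1, h2] at h0
  simp at h0

theorem partitionFunction_ne_top {d : ℕ} {lam : ℝ} (hlam : 0 ≤ lam) {A : Set (Space d)}
    (hA : volume A ≠ ∞) : partitionFunction lam A ≠ ∞ := by
  have hle : partitionFunction lam A ≤
      ∑' k : ℕ, ENNReal.ofReal ((lam * (volume A).toReal) ^ k / (k.factorial : ℝ)) := by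
    refine ENNReal.tsum_le_tsum fun k => ?_
    have h1 : volume (packings k A) ≤ volume A ^ k := by
      refine (measure_mono (t := Set.univ.pi fun _ => A) fun v hv i _ => hv.1 i).trans ?_
      rw [volume_pi, Measure.pi_pi]
      simp
    rw [mul_pow, mul_div_right_comm, ENNReal.ofReal_mul (by positivity),
      ENNReal.ofReal_pow ENNReal.toReal_nonneg, ENNReal.ofReal_toReal hA]
    gcongr
  refine ne_top_of_le_ne_top ?_ hle
  exact (Real.summable_pow_div_factorial _).tsum_ofReal_ne_top

theorem isProbabilityMeasure_hardLaw {d : ℕ} {lam : ℝ} (hlam : 0 ≤ lam) {A : Set (Space d)}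
    (hA : volume A ≠ ∞) : IsProbabilityMeasure (hardLaw lam A) := by
  constructor
  rw [hardLaw, Measure.smul_apply, Measure.sum_apply _ MeasurableSet.univ, smul_eq_mul]
  have h : ∀ k : ℕ, (ENNReal.ofReal (lam ^ k / (k.factorial : ℝ)) •
      (volume.restrict (packings k A)).map (fun v : Fin k → Space d => ofFamily v)) Set.univ =
      ENNReal.ofReal (lam ^ k / (k.factorial : ℝ)) * volume (packings k A) := fun k => by
    rw [Measure.smul_apply, Measure.map_apply (measurable_ofTuple k) MeasurableSet.univ]
    simp
  rw [tsum_congr h]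
  exact ENNReal.inv_mul_cancel (partitionFunction_ne_zero lam A) (partitionFunction_ne_top hlam hA)

theorem ae_hardLaw_mem_admissible {d : ℕ} (lam : ℝ) {A : Set (Space d)} (hA : MeasurableSet A) :
    ∀ᵐ Z ∂hardLaw lam A, Z ∈ admissible A := by
  classical
  have hm := measurableSet_admissible hA
  refine Measure.ae_smul_measure ?_ _
  change Measure.sum _ (admissible A)ᶜ = 0
  rw [Measure.sum_apply_eq_zero' hm.compl]
  intro k
  rw [Measure.smul_apply]
  have : ∀ᵐ Z ∂(volume.restrict (packings k A)).map (fun v : Fin k → Space d => ofFamily v),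
      Z ∈ admissible A := by
    refine (ae_map_iff (p := (· ∈ admissible A)) (measurable_ofTuple k).aemeasurable hm).2 ?_
    filter_upwards [ae_restrict_mem (measurableSet_packings hA)] with v hv
    constructor
    · intro x hx
      obtain ⟨i, -, rfl⟩ := Finset.mem_image.1 hx
      exact hv.1 i
    · intro x hx y hy hxy
      obtain ⟨i, -, rfl⟩ := Finset.mem_image.1 hx
      obtain ⟨j, -, rfl⟩ := Finset.mem_image.1 hy
      exact hv.2 i j fun hij => hxy (by rw [hij])
  rw [ae_iff] at this
  exact (congrArg _ this).trans (smul_zero _)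

/-! ### Total variation distance and integrals -/

theorem tvDist_bddAbove {S : Type} [MeasurableSpace S] (μ ν : Measure S) [IsProbabilityMeasure μ]
    [IsProbabilityMeasure ν] :
    BddAbove (Set.range fun A : {A : Set S // MeasurableSet A} => |μ.real A - ν.real A|) := by
  refine ⟨1, ?_⟩
  rintro _ ⟨A, rfl⟩
  have h1 := measureReal_le_one (μ := μ) (s := A)
  have h2 := measureReal_le_one (μ := ν) (s := A)
  have h3 := measureReal_nonneg (μ := μ) (s := A)
  have h4 := measureReal_nonneg (μ := ν) (s := A)
  exact abs_le.2 ⟨by linarith, by linarith⟩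

theorem tvDist_self {S : Type} [MeasurableSpace S] (μ : Measure S) : tvDist μ μ = 0 := by
  simp [tvDist]

theorem measure_le_add_tvDist {S : Type} [MeasurableSpace S] {μ ν : Measure S}
    [IsProbabilityMeasure μ] [IsProbabilityMeasure ν] {δ : ℝ} (hδ : tvDist μ ν ≤ δ) {A : Set S}
    (hA : MeasurableSet A) : μ A ≤ ν A + ENNReal.ofReal δ := by
  have h := (le_ciSup (tvDist_bddAbove μ ν) ⟨A, hA⟩).trans hδ
  have h1 : μ.real A ≤ ν.real A + δ := by linarith [(abs_le.1 h).2]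
  rw [← ofReal_measureReal (μ := μ), ← ofReal_measureReal (μ := ν)]
  exact (ENNReal.ofReal_le_ofReal h1).trans ENNReal.ofReal_add_le

/-- A function with values in an interval of length `D` has integrals that differ by at most `D`
times the total variation distance. -/
theorem lintegral_le_add_tvDist {S : Type} [MeasurableSpace S] {μ ν : Measure S}
    [IsProbabilityMeasure μ] [IsProbabilityMeasure ν] {δ : ℝ} (hδ : tvDist μ ν ≤ δ)
    {g : S → ℝ≥0∞} (hg : Measurable g) {a D : ℝ≥0∞} (hD : D ≠ ∞)
    (hμ : ∀ᵐ x ∂μ, a ≤ g x ∧ g x ≤ a + D) (hν : ∀ᵐ x ∂ν, a ≤ g x ∧ g x ≤ a + D) :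
    ∫⁻ x, g x ∂μ ≤ ∫⁻ x, g x ∂ν + D * ENNReal.ofReal δ := by
  -- The bounds on `g` hold only almost everywhere; truncating at `D` makes `h` real and bounded
  -- everywhere without changing the integrals.
  let h : S → ℝ := fun x => (min (g x - a) D).toReal
  have hm : Measurable h := ((hg.sub_const a).min measurable_const).ennreal_toReal
  have hnn : ∀ x, 0 ≤ h x := fun x => ENNReal.toReal_nonneg
  have hhD : ∀ x, h x ≤ D.toReal := fun x => ENNReal.toReal_mono hD (min_le_right _ _)
  -- Layer-cake formula: only levels in `(0, D]` matter, and at each level the two probabilities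
  -- differ by at most `δ`.
  have hrep : ∀ ρ : Measure S, IsProbabilityMeasure ρ → (∀ᵐ x ∂ρ, a ≤ g x ∧ g x ≤ a + D) →
      ∫⁻ x, g x ∂ρ = a + ∫⁻ t in Set.Ioc 0 D.toReal, ρ {x | t ≤ h x} := by
    intro ρ _ hρ
    have h1 : ∫⁻ x, g x ∂ρ = ∫⁻ x, a + ENNReal.ofReal (h x) ∂ρ := by
      refine lintegral_congr_ae ?_
      filter_upwards [hρ] with x hx
      have h2 : g x - a ≤ D := tsub_le_iff_left.2 hx.2
      simp only [h]
      rw [min_eq_left h2, ENNReal.ofReal_toReal (ne_top_of_le_ne_top hD h2),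
        add_tsub_cancel_of_le hx.1]
    rw [h1, lintegral_add_left measurable_const, lintegral_const, measure_univ, mul_one,
      lintegral_eq_lintegral_meas_le ρ (Filter.Eventually.of_forall hnn) hm.aemeasurable]
    congr 1
    rw [← Set.Ioc_union_Ioi_eq_Ioi (ENNReal.toReal_nonneg (a := D)),
      lintegral_union measurableSet_Ioi (Set.Ioc_disjoint_Ioi le_rfl)]
    have h3 : ∫⁻ t in Set.Ioi D.toReal, ρ {x | t ≤ h x} = 0 := by
      rw [setLIntegral_congr_fun (g := fun _ => 0) measurableSet_Ioi]
      · simp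
      · intro t ht
        have : {x | t ≤ h x} = ∅ := Set.eq_empty_of_forall_notMem fun x hx =>
          absurd (hx.trans (hhD x)) (not_le.2 ht)
        simp [this]
    rw [h3, add_zero]
  rw [hrep μ inferInstance hμ, hrep ν inferInstance hν, add_assoc]
  gcongr
  calc ∫⁻ t in Set.Ioc 0 D.toReal, μ {x | t ≤ h x}
      ≤ ∫⁻ t in Set.Ioc 0 D.toReal, (ν {x | t ≤ h x} + ENNReal.ofReal δ) :=
        lintegral_mono fun t => measure_le_add_tvDist hδ (measurableSet_le measurable_const hm)
    _ = _ := by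
        rw [lintegral_add_right _ measurable_const, setLIntegral_const, Real.volume_Ioc, sub_zero,
          ENNReal.ofReal_toReal hD, mul_comm]

/-! ### Observables with bounded increments -/

open scoped Classical in
/-- The configuration `X ∪ {v}`. -/
def Config.addPoint {d : ℕ} (v : Space d) (X : Config d) : Config d :=
  ⟨insert v X.centers⟩

/-- On admissible configurations in `A`, adding a point changes `f` by at most `l`. -/
def LipOn {d : ℕ} (A : Set (Space d)) (f : Config d → ℝ≥0∞) (l : ℝ≥0∞) : Prop :=
  ∀ (X : Config d) (v : Space d), v ∉ X.centers → X.addPoint v ∈ admissible A →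
    f X ≤ f (X.addPoint v) + l ∧ f (X.addPoint v) ≤ f X + l

theorem admissible_mono {d : ℕ} {A : Set (Space d)} {X Y : Config d}
    (hY : Y ∈ admissible A) (h : X.centers ⊆ Y.centers) : X ∈ admissible A :=
  ⟨fun x hx => hY.1 x (h hx), hY.2.mono h⟩

theorem LipOn.of_le_one {d : ℕ} (A : Set (Space d)) {f : Config d → ℝ≥0∞} (hf : ∀ X, f X ≤ 1) :
    LipOn A f 1 := fun X _ _ _ =>
  ⟨(hf X).trans le_add_self, (hf _).trans le_add_self⟩

/-- The points are added one at a time; every intermediate configuration is admissible because it is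
contained in the final one. -/
theorem LipOn.union {d : ℕ} {A : Set (Space d)} {f : Config d → ℝ≥0∞} {l : ℝ≥0∞}
    (hf : LipOn A f l) (X : Config d) (s : Finset (Space d)) (h : X.union ⟨s⟩ ∈ admissible A) :
    f X ≤ f (X.union ⟨s⟩) + s.card * l ∧ f (X.union ⟨s⟩) ≤ f X + s.card * l := by
  classical
  induction s using Finset.induction_on with
  | empty =>
    have : X.union ⟨∅⟩ = X := by ext; simp [Config.union]
    simp [this]
  | insert v s hv ih =>
    have hins : X.union ⟨insert v s⟩ = (X.union ⟨s⟩).addPoint v := by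
      ext
      simp [Config.union, Config.addPoint]
    have hs : X.union ⟨s⟩ ∈ admissible A := admissible_mono h (by
      rw [hins]; simp only [Config.addPoint]; exact Finset.subset_insert _ _)
    obtain ⟨h1, h2⟩ := ih hs
    rw [Finset.card_insert_of_notMem hv, hins]
    -- The point may already belong to `X`; `LipOn` is silent there, but the configuration does not
    -- change.
    by_cases hvX : v ∈ (X.union ⟨s⟩).centers
    · have : (X.union ⟨s⟩).addPoint v = X.union ⟨s⟩ := by
        ext
        simp only [Config.addPoint, Finset.insert_eq_of_mem hvX]
      rw [this]
      push_cast
      exact ⟨h1.trans (by gcongr; exact le_self_add), h2.trans (by gcongr; exact le_self_add)⟩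
    · rw [hins] at h
      obtain ⟨h3, h4⟩ := hf _ v hvX h
      push_cast
      rw [add_mul, one_mul]
      constructor
      · calc f X ≤ f (X.union ⟨s⟩) + s.card * l := h1
          _ ≤ f ((X.union ⟨s⟩).addPoint v) + l + s.card * l := by gcongr
          _ = _ := by ring
      · calc f ((X.union ⟨s⟩).addPoint v) ≤ f (X.union ⟨s⟩) + l := h4
          _ ≤ f X + s.card * l + l := by gcongr
          _ = _ := by ring

theorem LipOn.of_subset {d : ℕ} {A : Set (Space d)} {f : Config d → ℝ≥0∞} {l c : ℝ≥0∞}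
    (hf : LipOn A f l) {X Y : Config d} {s : Finset (Space d)} (hXY : Y = X.union ⟨s⟩)
    (hY : Y ∈ admissible A) (hc : (s.card : ℝ≥0∞) ≤ c) :
    f X ≤ f Y + c * l ∧ f Y ≤ f X + c * l := by
  subst hXY
  obtain ⟨h1, h2⟩ := hf.union X s hY
  exact ⟨h1.trans (by gcongr), h2.trans (by gcongr)⟩

/-! ### Spatial mixing in a ball -/

/-- The centers of spheres that lie in the ball `B_{L + r}(x)` and avoid `B_R(v)`. -/
def farRegion {d : ℕ} (x v : Space d) (L R : ℝ) : Set (Space d) :=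
  innerRegion (Metric.closedBall x (L + radius d) \ Metric.ball v R)

theorem measurableSet_farRegion {d : ℕ} (x v : Space d) (L R : ℝ) :
    MeasurableSet (farRegion x v L R) :=
  measurableSet_innerRegion (Metric.isClosed_closedBall.measurableSet.diff
    Metric.isOpen_ball.measurableSet)

/-- The sphere about `z` stays inside `B_{L + r}(x)`, so it can fail to be in the far region only by
meeting `B_R(v)`. -/
theorem mem_ball_of_notMem_farRegion {d : ℕ} {x v z : Space d} {L R : ℝ}
    (hz : z ∈ Metric.ball x L) (h : z ∉ farRegion x v L R) :
    z ∈ Metric.ball v (R + radius d) := by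
  by_contra hzv
  refine h (mem_innerRegion.2 fun y hy => ⟨?_, fun hyv => ?_⟩)
  · rw [Metric.mem_ball] at hy hz
    rw [Metric.mem_closedBall]
    linarith [dist_triangle y z x]
  · rw [Metric.mem_ball] at hy hzv hyv
    rw [dist_comm] at hy
    linarith [dist_triangle z y v]

/-- The bound of strong spatial mixing with parameters `α`, `β`. -/
def SpatialMixingWith (d : ℕ) (lam α β : ℝ) : Prop :=
  ∀ Λ' Λ : Set (Space d), IsCompact Λ' → IsCompact Λ → Λ' ⊆ Λ →
    ∀ τ τ' : Set (Space d), IsBoundary Λ τ → IsBoundary Λ τ' →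
      tvDistOn Λ' (gibbs lam Λ τ) (gibbs lam Λ τ') ≤
        β * (volume Λ').toReal * Real.exp (-(α * (setDist (symmDiff τ τ') Λ').toReal))

/-- The total variation bound for two regions in a ball of radius `L` that differ near a point. -/
def mixingError (d : ℕ) (α β L R : ℝ) : ℝ :=
  β * ((L + 2 * radius d) / radius d) ^ d * Real.exp (-(α * (R - 2 * radius d)))

/-- Any measurable `A ⊆ B_L(x)` is what remains of the inner region of the closed ball of radius `L
+ r` under the boundary condition that forbids its complement. The laws on `A` and `A'` are thus
Gibbs measures on one compact set, with boundary conditions that differ only within `2r` of `v`,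
hence at distance at least `R - 2r` from the complement of `B_R(v)`. -/
theorem tvDist_farRegion_le {d : ℕ} (hd : 0 < d) {lam α β : ℝ} (hα : 0 < α) (hβ : 0 < β)
    (hmix : SpatialMixingWith d lam α β) {x v : Space d} {L R : ℝ} (hL : 0 < L)
    {A A' : Set (Space d)} (hA : MeasurableSet A) (hA' : MeasurableSet A')
    (hAb : A ⊆ Metric.ball x L) (hAb' : A' ⊆ Metric.ball x L)
    (hdiff : symmDiff A A' ⊆ Metric.ball v (2 * radius d)) :
    tvDist ((hardLaw lam A).map (Config.restrict (farRegion x v L R)))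
      ((hardLaw lam A').map (Config.restrict (farRegion x v L R))) ≤ mixingError d α β L R := by
  have hr := radius_pos d
  have herr : 0 ≤ mixingError d α β L R := by unfold mixingError; positivity
  -- Equal regions would give distance `∞`, which `toReal` sends to `0`, destroying the decay; the
  -- case is settled separately.
  by_cases hAA : A = A'
  · rw [hAA, tvDist_self]
    exact herr
  set Λ : Set (Space d) := Metric.closedBall x (L + radius d) with hΛ
  set Λ' : Set (Space d) := Λ \ Metric.ball v R with hΛ'
  have hΛc : IsCompact Λ := isCompact_closedBall _ _
  have hsub : ∀ B : Set (Space d), B ⊆ Metric.ball x L → B ⊆ innerRegion Λ := by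
    intro B hB z hz
    refine mem_innerRegion.2 fun y hy => ?_
    have := Metric.mem_ball.1 (hB hz)
    rw [Metric.mem_ball] at hy
    rw [hΛ, Metric.mem_closedBall]
    linarith [dist_triangle y z x]
  have hI : MeasurableSet (innerRegion Λ) := measurableSet_innerRegion hΛc.measurableSet
  have hgibbs : ∀ B : Set (Space d), B ⊆ Metric.ball x L →
      gibbs lam Λ (innerRegion Λ \ B) = hardLaw lam B := fun B hB => by
    rw [gibbs, Set.sdiff_sdiff_cancel_left (hsub B hB)]
  have hsd : symmDiff (innerRegion Λ \ A) (innerRegion Λ \ A') ⊆ symmDiff A A' := by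
    rintro z (⟨⟨h1, h2⟩, h3⟩ | ⟨⟨h1, h2⟩, h3⟩)
    · exact Or.inr ⟨by_contra fun h => h3 ⟨h1, h⟩, h2⟩
    · exact Or.inl ⟨by_contra fun h => h3 ⟨h1, h⟩, h2⟩
  have hne : (symmDiff (innerRegion Λ \ A) (innerRegion Λ \ A')).Nonempty := by
    rw [Set.nonempty_iff_ne_empty]
    intro h
    refine hAA ?_
    have h1 : innerRegion Λ \ A = innerRegion Λ \ A' := symmDiff_eq_bot.1 h
    rw [← Set.sdiff_sdiff_cancel_left (hsub A hAb), h1, Set.sdiff_sdiff_cancel_left (hsub A' hAb')]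
  have h := hmix Λ' Λ (hΛc.diff Metric.isOpen_ball) hΛc Set.sdiff_subset (innerRegion Λ \ A)
    (innerRegion Λ \ A') ⟨hI.diff hA, Set.sdiff_subset⟩ ⟨hI.diff hA', Set.sdiff_subset⟩
  rw [hgibbs A hAb, hgibbs A' hAb'] at h
  refine le_trans h ?_
  -- For empty `Λ'` the distance is again `∞`, but the factor `|Λ'| = 0` saves the bound.
  rcases Set.eq_empty_or_nonempty Λ' with hempty | ⟨y₀, hy₀⟩
  · rw [hempty]
    simpa using herr
  have hvol : (volume Λ').toReal ≤ ((L + 2 * radius d) / radius d) ^ d := by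
    refine ENNReal.toReal_le_of_le_ofReal (by positivity) ?_
    rw [← volume_ball hd x (by positivity)]
    refine measure_mono (Set.sdiff_subset.trans (Metric.closedBall_subset_ball ?_))
    linarith
  obtain ⟨x₀, hx₀⟩ := hne
  have hfin : setDist (symmDiff (innerRegion Λ \ A) (innerRegion Λ \ A')) Λ' ≠ ∞ := by
    refine ne_top_of_le_ne_top (edist_ne_top x₀ y₀) ?_
    exact (iInf₂_le x₀ hx₀).trans (Metric.infEDist_le_edist_of_mem hy₀)
  have hdist : R - 2 * radius d ≤
      (setDist (symmDiff (innerRegion Λ \ A) (innerRegion Λ \ A')) Λ').toReal := by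
    refine (ENNReal.ofReal_le_iff_le_toReal hfin).1 ?_
    refine le_iInf₂ fun z hz => Metric.le_infEDist.2 fun y hy => ?_
    rw [edist_dist]
    refine ENNReal.ofReal_le_ofReal ?_
    have h1 := Metric.mem_ball.1 (hdiff (hsd hz))
    have h2 := hy.2
    rw [Metric.mem_ball, not_lt] at h2
    rw [dist_comm] at h1 h2
    linarith [dist_triangle v z y]
  unfold mixingError
  gcongr

/-- A bound for the expected number of additional discrepancies after updating a ball of radius
`L` next to a discrepancy. -/
def spread (d : ℕ) (α β L R : ℝ) : ℝ :=
  2 * ((R + 2 * radius d) / radius d) ^ d +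
    2 * ((L + radius d) / radius d) ^ d * mixingError d α β L R

theorem lintegral_add_const {S : Type} [MeasurableSpace S] {μ : Measure S}
    [IsProbabilityMeasure μ] (f : S → ℝ≥0∞) (c : ℝ≥0∞) :
    ∫⁻ x, f x + c ∂μ = ∫⁻ x, f x ∂μ + c := by
  rw [lintegral_add_right _ measurable_const, lintegral_const, measure_univ, mul_one]

/-! ### Two updates of a ball whose available regions differ near one point -/

section Shell

variable {d : ℕ} {lam α β L R : ℝ} {A A₁ A₂ : Set (Space d)} {W : Config d} {x v : Space d}
  {f : Config d → ℝ≥0∞} {l : ℝ≥0∞}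

theorem union_restrict_compl (W Z : Config d) (F : Set (Space d)) :
    W.union Z = (W.union (Z.restrict F)).union ⟨(Z.restrict Fᶜ).centers⟩ := by
  classical
  ext y
  simp only [Config.union, Config.restrict, Finset.mem_union, Finset.mem_filter,
    Set.mem_compl_iff]
  tauto

theorem addPoint_eq_union (X : Config d) (v : Space d) : X.addPoint v = X.union ⟨{v}⟩ := by
  classical
  ext y
  simp [Config.addPoint, Config.union]

theorem restrict_subset (F : Set (Space d)) (Z : Config d) :
    (Z.restrict F).centers ⊆ Z.centers := by
  classical
  exact Finset.filter_subset _ _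

theorem mem_restrict {F : Set (Space d)} {Z : Config d} {z : Space d} :
    z ∈ (Z.restrict F).centers ↔ z ∈ Z.centers ∧ z ∈ F :=
  by classical exact Finset.mem_filter

/-- Passing to the far region discards only centers in `B_{R + r}(v)`, whose number is bounded by
volume. -/
theorem LipOn.union_farRegion (hd : 0 < d) (hR : 0 ≤ R) (hf : LipOn A f l)
    {Z : Config d} (hZ : Z ∈ admissible A₁) (hb : A₁ ⊆ Metric.ball x L)
    (hWZ : W.union Z ∈ admissible A) :
    f (W.union (Z.restrict (farRegion x v L R))) ≤ f (W.union Z) +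
        ENNReal.ofReal (((R + 2 * radius d) / radius d) ^ d) * l ∧
      f (W.union Z) ≤ f (W.union (Z.restrict (farRegion x v L R))) +
        ENNReal.ofReal (((R + 2 * radius d) / radius d) ^ d) * l := by
  classical
  have hr := radius_pos d
  refine hf.of_subset (union_restrict_compl W Z _) hWZ ?_
  have h := (hZ.2.mono (restrict_subset (farRegion x v L R)ᶜ Z)).card_le_of_ball hd
    (c := v) (ρ := R + radius d) (by positivity) (fun z hz => by
      have hz' := mem_restrict.1 hz
      exact mem_ball_of_notMem_farRegion (hb (hZ.1 z hz'.1)) hz'.2)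
  rwa [add_assoc, ← two_mul] at h

/-- A bounded number of centers fits in `B_L(x)`, so `f` stays in an interval around `f W` that does
not depend on `Z`. This is the form in which `lintegral_le_add_tvDist` needs the bound. -/
theorem LipOn.union_oscillation (hd : 0 < d) (hL : 0 ≤ L) (hf : LipOn A f l) (F : Set (Space d))
    {Z : Config d} (hZ : Z ∈ admissible A₁) (hb : A₁ ⊆ Metric.ball x L)
    (hWZ : W.union Z ∈ admissible A) :
    f W - ENNReal.ofReal (((L + radius d) / radius d) ^ d) * l ≤ f (W.union (Z.restrict F)) ∧
      f (W.union (Z.restrict F)) ≤ f W - ENNReal.ofReal (((L + radius d) / radius d) ^ d) * l +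
        2 * ENNReal.ofReal (((L + radius d) / radius d) ^ d) * l := by
  classical
  have hsub : (W.union (Z.restrict F)).centers ⊆ (W.union Z).centers :=
    Finset.union_subset_union_right (restrict_subset F Z)
  obtain ⟨h1, h2⟩ := hf.of_subset (X := W) (s := (Z.restrict F).centers) rfl
    (admissible_mono hWZ hsub)
    ((hZ.2.mono (restrict_subset F Z)).card_le_of_ball hd hL
      fun z hz => hb (hZ.1 z (restrict_subset F Z hz)))
  refine ⟨tsub_le_iff_right.2 h1, h2.trans ?_⟩
  -- The lower end of the interval is a truncated difference; adding the subtracted term back still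
  -- gives at least `f W`.
  rw [mul_assoc, two_mul, ← add_assoc]
  gcongr
  exact le_tsub_add

/-- Comparison of the averages of an observable before and after adding the point `v`, when the
remaining points are sampled in regions `A₁` and `A₂` that differ only near `v`. -/
theorem LipOn.lintegral_hardLaw_shell (hd : 0 < d) (hlam : 0 ≤ lam) (hα : 0 < α) (hβ : 0 < β)
    (hmix : SpatialMixingWith d lam α β) (hL : 0 < L) (hR : 0 ≤ R)
    (hf : LipOn A f l) (hfm : Measurable f) (hl : l ≠ ∞)
    (hA₁ : MeasurableSet A₁) (hA₂ : MeasurableSet A₂)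
    (hb₁ : A₁ ⊆ Metric.ball x L) (hb₂ : A₂ ⊆ Metric.ball x L)
    (hdiff : symmDiff A₁ A₂ ⊆ Metric.ball v (2 * radius d))
    (h₁ : ∀ Z ∈ admissible A₁, W.union Z ∈ admissible A)
    (h₂ : ∀ Z ∈ admissible A₂, (W.union Z).addPoint v ∈ admissible A) :
    ∫⁻ Z, f (W.union Z) ∂hardLaw lam A₁ ≤ ∫⁻ Z, f ((W.union Z).addPoint v) ∂hardLaw lam A₂ +
        (1 + ENNReal.ofReal (spread d α β L R)) * l ∧
      ∫⁻ Z, f ((W.union Z).addPoint v) ∂hardLaw lam A₂ ≤ ∫⁻ Z, f (W.union Z) ∂hardLaw lam A₁ +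
        (1 + ENNReal.ofReal (spread d α β L R)) * l := by
  classical
  have hr := radius_pos d
  have hfin : ∀ {B : Set (Space d)}, B ⊆ Metric.ball x L → volume B ≠ ∞ := fun hB =>
    ne_top_of_le_ne_top measure_ball_lt_top.ne (measure_mono hB)
  have hp₁ := isProbabilityMeasure_hardLaw hlam (hfin hb₁)
  have hp₂ := isProbabilityMeasure_hardLaw hlam (hfin hb₂)
  set F := farRegion x v L R with hF
  have hFm : Measurable (Config.restrict F) := measurable_restrict (measurableSet_farRegion x v L R)
  have hq₁ := Measure.isProbabilityMeasure_map (μ := hardLaw lam A₁) hFm.aemeasurable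
  have hq₂ := Measure.isProbabilityMeasure_map (μ := hardLaw lam A₂) hFm.aemeasurable
  set K := ENNReal.ofReal (((R + 2 * radius d) / radius d) ^ d) with hK
  set M := ENNReal.ofReal (((L + radius d) / radius d) ^ d) with hM
  set δ := mixingError d α β L R with hδ
  have hδ0 : 0 ≤ δ := by rw [hδ]; unfold mixingError; positivity
  have hspread : ENNReal.ofReal (spread d α β L R) = 2 * K + 2 * M * ENNReal.ofReal δ := by
    rw [spread, ENNReal.ofReal_add (by positivity) (by positivity),
      ENNReal.ofReal_mul (by positivity), ENNReal.ofReal_mul (by positivity),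
      ENNReal.ofReal_mul (by positivity), ENNReal.ofReal_ofNat]
  have h₂' : ∀ Z ∈ admissible A₂, W.union Z ∈ admissible A := fun Z hZ =>
    admissible_mono (h₂ Z hZ) (Finset.subset_insert _ _)
  have hosc : ∀ {B : Set (Space d)}, MeasurableSet B → B ⊆ Metric.ball x L →
      (∀ Z ∈ admissible B, W.union Z ∈ admissible A) →
      ∀ᵐ Z ∂(hardLaw lam B).map (Config.restrict F),
        f W - M * l ≤ f (W.union Z) ∧ f (W.union Z) ≤ f W - M * l + 2 * M * l := by
    intro B hB hBb hBA
    have hm := hfm.comp (measurable_union W)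
    refine (ae_map_iff hFm.aemeasurable ((measurableSet_le measurable_const hm).inter
      (measurableSet_le hm measurable_const))).2 ?_
    filter_upwards [ae_hardLaw_mem_admissible lam hB] with Z hZ
    exact hf.union_oscillation hd hL.le F hZ hBb (hBA Z hZ)
  have htv := tvDist_farRegion_le hd hα hβ hmix (R := R) hL hA₁ hA₂ hb₁ hb₂ hdiff
  have htv' := tvDist_farRegion_le hd hα hβ hmix (R := R) hL hA₂ hA₁ hb₂ hb₁
    (by rwa [symmDiff_comm])
  have hD : 2 * M * l ≠ ∞ := ENNReal.mul_ne_top (ENNReal.mul_ne_top (by simp) (by simp [hM])) hl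
  have hgm : Measurable fun Z => f (W.union Z) := hfm.comp (measurable_union W)
  -- Spatial mixing is applied only to the traces on `F`; exchanging their laws costs the
  -- oscillation `2 M l` times `δ`.
  have key := lintegral_le_add_tvDist htv hgm hD (hosc hA₁ hb₁ h₁) (hosc hA₂ hb₂ h₂')
  have key' := lintegral_le_add_tvDist htv' hgm hD (hosc hA₂ hb₂ h₂') (hosc hA₁ hb₁ h₁)
  rw [lintegral_map hgm hFm, lintegral_map hgm hFm] at key key'
  have hadd : ∀ Z ∈ admissible A₂, f (W.union Z) ≤ f ((W.union Z).addPoint v) + 1 * l ∧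
      f ((W.union Z).addPoint v) ≤ f (W.union Z) + 1 * l := fun Z hZ =>
    hf.of_subset (addPoint_eq_union _ v) (h₂ Z hZ) (by simp)
  -- Discarding the near centers costs `K l` under each of the two laws and inserting `v` costs `l`.
  -- With the `2 M δ l` of the exchange, the total is `(1 + spread) l`.
  have e1 : ∫⁻ Z, f (W.union Z) ∂hardLaw lam A₁ ≤
      ∫⁻ Z, f (W.union (Z.restrict F)) ∂hardLaw lam A₁ + K * l := by
    rw [← lintegral_add_const]
    refine lintegral_mono_ae ?_
    filter_upwards [ae_hardLaw_mem_admissible lam hA₁] with Z hZ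
    exact (hf.union_farRegion hd hR hZ hb₁ (h₁ Z hZ)).2
  have e2 : ∫⁻ Z, f (W.union (Z.restrict F)) ∂hardLaw lam A₁ ≤
      ∫⁻ Z, f (W.union Z) ∂hardLaw lam A₁ + K * l := by
    rw [← lintegral_add_const]
    refine lintegral_mono_ae ?_
    filter_upwards [ae_hardLaw_mem_admissible lam hA₁] with Z hZ
    exact (hf.union_farRegion hd hR hZ hb₁ (h₁ Z hZ)).1
  have e3 : ∫⁻ Z, f (W.union (Z.restrict F)) ∂hardLaw lam A₂ ≤
      ∫⁻ Z, f ((W.union Z).addPoint v) ∂hardLaw lam A₂ + (1 + K) * l := by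
    rw [← lintegral_add_const]
    refine lintegral_mono_ae ?_
    filter_upwards [ae_hardLaw_mem_admissible lam hA₂] with Z hZ
    refine (hf.union_farRegion hd hR hZ hb₂ (h₂' Z hZ)).1.trans ?_
    rw [add_mul, ← add_assoc]
    gcongr
    exact (hadd Z hZ).1
  have e4 : ∫⁻ Z, f ((W.union Z).addPoint v) ∂hardLaw lam A₂ ≤
      ∫⁻ Z, f (W.union (Z.restrict F)) ∂hardLaw lam A₂ + (1 + K) * l := by
    rw [← lintegral_add_const]
    refine lintegral_mono_ae ?_
    filter_upwards [ae_hardLaw_mem_admissible lam hA₂] with Z hZ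
    refine (hadd Z hZ).2.trans ?_
    rw [add_comm 1 K, add_mul, ← add_assoc]
    gcongr
    exact (hf.union_farRegion hd hR hZ hb₂ (h₂' Z hZ)).2
  rw [hspread]
  constructor
  · refine e1.trans ((add_le_add_left (key.trans (add_le_add_left e3 _)) _).trans ?_)
    exact le_of_eq (by ring)
  · refine e4.trans ((add_le_add_left (key'.trans (add_le_add_left e2 _)) _).trans ?_)
    exact le_of_eq (by ring)

end Shell

/-! ### One step of the heat-bath dynamics -/

section Step

variable {d : ℕ} {lam α β L R : ℝ} {Λ τ : Set (Space d)} {X : Config d} {x v : Space d}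
  {f : Config d → ℝ≥0∞} {l : ℝ≥0∞}

theorem available_subset_ball : available Λ τ L X x ⊆ Metric.ball x L := fun _ h => h.2.1

theorem measurableSet_available (hΛ : MeasurableSet Λ) (hτ : MeasurableSet τ) :
    MeasurableSet (available Λ τ L X x) := by
  have h : available Λ τ L X x = (innerRegion Λ \ τ) ∩ (Metric.ball x L ∩
      ⋂ y ∈ X.centers, {z | y ∉ Metric.ball x L → 2 * radius d ≤ dist z y}) := by
    ext z
    simp only [available, Set.mem_ofPred_eq, Set.mem_inter_iff, Set.mem_iInter]
  rw [h]
  refine ((measurableSet_innerRegion hΛ).diff hτ).inter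
    (Metric.isOpen_ball.measurableSet.inter (Finset.measurableSet_biInter _ fun y _ => ?_))
  by_cases hy : y ∈ Metric.ball x L
  · simp [hy]
  · simpa [hy] using measurableSet_le measurable_const
      (measurable_id.dist measurable_const : Measurable fun z : Space d => dist z y)

theorem union_mem_admissible (hX : X ∈ admissible (innerRegion Λ \ τ)) {Z : Config d}
    (hZ : Z ∈ admissible (available Λ τ L X x)) :
    (X.restrict (Metric.ball x L)ᶜ).union Z ∈ admissible (innerRegion Λ \ τ) := by
  classical
  constructor
  · intro y hy
    rcases Finset.mem_union.1 hy with hy | hy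
    · exact hX.1 y (mem_restrict.1 hy).1
    · exact (hZ.1 y hy).1
  · intro y hy z hz hyz
    rcases Finset.mem_union.1 hy with hy | hy <;> rcases Finset.mem_union.1 hz with hz | hz
    · exact hX.2 y (mem_restrict.1 hy).1 z (mem_restrict.1 hz).1 hyz
    · rw [dist_comm]
      exact (hZ.1 z hz).2.2 y (mem_restrict.1 hy).1 (mem_restrict.1 hy).2
    · exact (hZ.1 y hy).2.2 z (mem_restrict.1 hz).1 (mem_restrict.1 hz).2
    · exact hZ.2 y hy z hz hyz

theorem mem_addPoint {y : Space d} : y ∈ (X.addPoint v).centers ↔ y = v ∨ y ∈ X.centers := by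
  classical
  exact Finset.mem_insert

theorem mem_union {Y : Config d} {y : Space d} :
    y ∈ (X.union Y).centers ↔ y ∈ X.centers ∨ y ∈ Y.centers := by
  classical
  exact Finset.mem_union

theorem addPoint_union (W Z : Config d) :
    (W.addPoint v).union Z = (W.union Z).addPoint v := by
  ext y
  simp only [mem_union, mem_addPoint, or_assoc]

theorem restrict_addPoint_of_notMem {F : Set (Space d)} (hv : v ∉ F) :
    (X.addPoint v).restrict F = X.restrict F := by
  ext y
  simp only [mem_restrict, mem_addPoint]
  constructor
  · rintro ⟨rfl | h, h'⟩
    exacts [absurd h' hv, ⟨h, h'⟩]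
  · exact fun h => ⟨Or.inr h.1, h.2⟩

theorem restrict_addPoint_of_mem {F : Set (Space d)} (hv : v ∈ F) :
    (X.addPoint v).restrict F = (X.restrict F).addPoint v := by
  ext y
  simp only [mem_restrict, mem_addPoint]
  constructor
  · rintro ⟨rfl | h, h'⟩
    exacts [Or.inl rfl, Or.inr ⟨h, h'⟩]
  · rintro (rfl | h)
    exacts [⟨Or.inl rfl, hv⟩, ⟨Or.inr h.1, h.2⟩]

theorem available_addPoint_of_mem_ball (hv : v ∈ Metric.ball x L) :
    available Λ τ L (X.addPoint v) x = available Λ τ L X x := by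
  ext z
  simp only [available, Set.mem_ofPred_eq, mem_addPoint]
  refine and_congr_right fun _ => and_congr_right fun _ =>
    ⟨fun h y hy => h y (Or.inr hy), ?_⟩
  rintro h y (rfl | hy) hyb
  exacts [absurd hv hyb, h y hy hyb]

/-- Every point of `B_L(x)` is then at distance more than `2r` from `v`, so `v` blocks nothing. -/
theorem available_addPoint_of_far (hv : L + 2 * radius d ≤ dist v x) :
    available Λ τ L (X.addPoint v) x = available Λ τ L X x := by
  ext z
  simp only [available, Set.mem_ofPred_eq, mem_addPoint]
  refine and_congr_right fun _ => and_congr_right fun hz =>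
    ⟨fun h y hy => h y (Or.inr hy), ?_⟩
  rintro h y (rfl | hy) hyb
  · rw [Metric.mem_ball] at hz
    rw [dist_comm] at hv
    linarith [dist_triangle x z y, dist_comm x z]
  · exact h y hy hyb

theorem symmDiff_available_addPoint :
    symmDiff (available Λ τ L X x) (available Λ τ L (X.addPoint v) x) ⊆
      Metric.ball v (2 * radius d) := by
  rintro z (⟨h1, h2⟩ | ⟨h1, h2⟩)
  · by_contra hz
    refine h2 ⟨h1.1, h1.2.1, fun y hy hyb => ?_⟩
    rcases mem_addPoint.1 hy with rfl | hy
    · simpa using hz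
    · exact h1.2.2 y hy hyb
  · exact absurd ⟨h1.1, h1.2.1, fun y hy => h1.2.2 y (mem_addPoint.2 (Or.inr hy))⟩ h2

theorem lintegral_resample (hf : Measurable f) :
    ∫⁻ Y, f Y ∂resample lam Λ τ L X x =
      ∫⁻ Z, f ((X.restrict (Metric.ball x L)ᶜ).union Z) ∂hardLaw lam (available Λ τ L X x) :=
  lintegral_map hf (measurable_union _)

/-- The factor by which the influence of a center `v` can grow when the ball `B_L(x)` is
resampled. -/
def influence (d : ℕ) (v : Space d) (L c : ℝ) : Space d → ℝ≥0∞ := fun x =>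
  (Metric.ball v L)ᶜ.indicator (fun _ => 1) x +
    (Metric.ball v (L + 2 * radius d) \ Metric.ball v L).indicator (fun _ => ENNReal.ofReal c) x

/-- Three cases according to the distance from `v` to `x`: below `L` the discrepancy is erased
(factor `0`), in the shell it persists and may spread (factor `1 + spread`), beyond the shell it
merely persists (factor `1`). -/
theorem LipOn.resample (hd : 0 < d) (hlam : 0 ≤ lam) (hα : 0 < α) (hβ : 0 < β)
    (hmix : SpatialMixingWith d lam α β) (hL : 0 < L) (hR : 0 ≤ R)
    (hΛ : MeasurableSet Λ) (hτ : MeasurableSet τ)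
    (hf : LipOn (innerRegion Λ \ τ) f l) (hfm : Measurable f) (hl : l ≠ ∞)
    (hX : X.addPoint v ∈ admissible (innerRegion Λ \ τ)) (x : Space d) :
    ∫⁻ Y, f Y ∂resample lam Λ τ L X x ≤ ∫⁻ Y, f Y ∂resample lam Λ τ L (X.addPoint v) x +
        influence d v L (spread d α β L R) x * l ∧
      ∫⁻ Y, f Y ∂resample lam Λ τ L (X.addPoint v) x ≤ ∫⁻ Y, f Y ∂resample lam Λ τ L X x +
        influence d v L (spread d α β L R) x * l := by
  have hr := radius_pos d
  have hX' : X ∈ admissible (innerRegion Λ \ τ) :=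
    admissible_mono hX fun y hy => mem_addPoint.2 (Or.inr hy)
  rw [lintegral_resample hfm, lintegral_resample hfm]
  rcases lt_or_ge (dist v x) L with hvx | hvx
  · have hv : v ∈ Metric.ball x L := hvx
    rw [restrict_addPoint_of_notMem (by simpa using hvx), available_addPoint_of_mem_ball hv]
    exact ⟨le_self_add, le_self_add⟩
  have hv : v ∈ (Metric.ball x L)ᶜ := by simpa using hvx
  have hadm : ∀ Z ∈ admissible (available Λ τ L (X.addPoint v) x),
      ((X.restrict (Metric.ball x L)ᶜ).union Z).addPoint v ∈ admissible (innerRegion Λ \ τ) := by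
    intro Z hZ
    rw [← addPoint_union, ← restrict_addPoint_of_mem hv]
    exact union_mem_admissible hX hZ
  rw [restrict_addPoint_of_mem hv]
  simp only [addPoint_union]
  rw [dist_comm] at hvx
  rcases lt_or_ge (dist v x) (L + 2 * radius d) with hvx' | hvx'
  · have hi : influence d v L (spread d α β L R) x = 1 + ENNReal.ofReal (spread d α β L R) := by
      rw [dist_comm] at hvx'
      simp [influence, hvx, hvx']
    rw [hi]
    exact hf.lintegral_hardLaw_shell hd hlam hα hβ hmix hL hR hfm hl
      (measurableSet_available hΛ hτ) (measurableSet_available hΛ hτ) available_subset_ball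
      available_subset_ball symmDiff_available_addPoint
      (fun Z hZ => union_mem_admissible hX' hZ) hadm
  · have hi : influence d v L (spread d α β L R) x = 1 := by
      rw [dist_comm] at hvx'
      simp [influence, hvx, hvx']
    rw [available_addPoint_of_far hvx'] at hadm ⊢
    rw [hi]
    have hp : IsProbabilityMeasure (hardLaw lam (available Λ τ L X x)) :=
      isProbabilityMeasure_hardLaw hlam
        (ne_top_of_le_ne_top measure_ball_lt_top.ne (measure_mono available_subset_ball))
    have hstep : ∀ Z ∈ admissible (available Λ τ L X x),
        f ((X.restrict (Metric.ball x L)ᶜ).union Z) ≤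
          f (((X.restrict (Metric.ball x L)ᶜ).union Z).addPoint v) + 1 * l ∧
        f (((X.restrict (Metric.ball x L)ᶜ).union Z).addPoint v) ≤
          f ((X.restrict (Metric.ball x L)ᶜ).union Z) + 1 * l := fun Z hZ =>
      hf.of_subset (addPoint_eq_union _ v) (hadm Z hZ) (by simp)
    constructor
    · rw [← lintegral_add_const]
      refine lintegral_mono_ae ?_
      filter_upwards [ae_hardLaw_mem_admissible lam (measurableSet_available hΛ hτ)] with Z hZ
      exact (hstep Z hZ).1
    · rw [← lintegral_add_const]
      refine lintegral_mono_ae ?_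
      filter_upwards [ae_hardLaw_mem_admissible lam (measurableSet_available hΛ hτ)] with Z hZ
      exact (hstep Z hZ).2

theorem measurable_influence (v : Space d) (L c : ℝ) : Measurable (influence d v L c) :=
  (measurable_const.indicator Metric.isOpen_ball.measurableSet.compl).add
    (measurable_const.indicator
      (Metric.isOpen_ball.measurableSet.diff Metric.isOpen_ball.measurableSet))

/-- If the volume of the ball of radius `L` dominates `c` times that of the surrounding shell, then
the average influence of a center is less than one. -/
theorem lintegral_influence_le (hd : 0 < d) (hL : 0 < L) {c : ℝ} (hc : 0 ≤ c)
    (hgap : 1 ≤ (L / radius d) ^ d -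
      c * (((L + 2 * radius d) / radius d) ^ d - (L / radius d) ^ d))
    {T : Set (Space d)} (hT : MeasurableSet T) (hT' : volume T ≠ ∞)
    (hv : Metric.ball v L ⊆ T) :
    ∫⁻ x, influence d v L c x ∂(ProbabilityTheory.cond volume T) ≤
      ENNReal.ofReal (1 - (volume T).toReal⁻¹) := by
  have hr := radius_pos d
  have hball : volume (Metric.ball v L) = ENNReal.ofReal ((L / radius d) ^ d) :=
    volume_ball hd v hL.le
  have hpos : 0 < (volume T).toReal := by
    refine ENNReal.toReal_pos (fun h => ?_) hT'
    have := measure_mono_null hv h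
    exact (Metric.measure_ball_pos volume v hL).ne' this
  set m := ProbabilityTheory.cond volume T with hm
  have hmp : IsProbabilityMeasure m :=
    cond_isProbabilityMeasure_of_finite (fun h => by simp [h] at hpos) hT'
  have hmreal : ∀ S, m.real S = (volume T).toReal⁻¹ * volume.real (T ∩ S) := fun S => by
    rw [hm, measureReal_def, cond_apply hT, ENNReal.toReal_mul, ENNReal.toReal_inv]
    rfl
  have h1 : m.real (Metric.ball v L)ᶜ = 1 - (volume T).toReal⁻¹ * (L / radius d) ^ d := by
    rw [probReal_compl_eq_one_sub Metric.isOpen_ball.measurableSet, hmreal,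
      Set.inter_eq_right.2 hv, measureReal_def, hball, ENNReal.toReal_ofReal (by positivity)]
  -- The shell may stick out of `T`, so its probability is only bounded above, whereas that of the
  -- ball is exact because `B_L(v) ⊆ T`.
  have h2 : m.real (Metric.ball v (L + 2 * radius d) \ Metric.ball v L) ≤ (volume T).toReal⁻¹ *
      (((L + 2 * radius d) / radius d) ^ d - (L / radius d) ^ d) := by
    rw [hmreal]
    gcongr
    refine (measureReal_mono Set.inter_subset_right
      (ne_top_of_le_ne_top measure_ball_lt_top.ne (measure_mono Set.sdiff_subset))).trans ?_
    rw [measureReal_sdiff (Metric.ball_subset_ball (by linarith))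
      Metric.isOpen_ball.measurableSet measure_ball_lt_top.ne, measureReal_def, measureReal_def,
      hball, volume_ball hd v (by positivity), ENNReal.toReal_ofReal (by positivity),
      ENNReal.toReal_ofReal (by positivity)]
  unfold influence
  rw [lintegral_add_left (measurable_const.indicator Metric.isOpen_ball.measurableSet.compl),
    lintegral_indicator_const Metric.isOpen_ball.measurableSet.compl, lintegral_indicator_const
      (Metric.isOpen_ball.measurableSet.diff Metric.isOpen_ball.measurableSet), one_mul,
    ← ofReal_measureReal, ← ofReal_measureReal, ← ENNReal.ofReal_mul hc,
    ← ENNReal.ofReal_add measureReal_nonneg (by positivity)]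
  refine ENNReal.ofReal_le_ofReal ?_
  rw [h1]
  have h3 := mul_le_mul_of_nonneg_left h2 hc
  have h4 := mul_le_mul_of_nonneg_left hgap (inv_pos.2 hpos).le
  nlinarith

/-- The contraction. Update centers range over the parallel set of `Λ_Int`, so `B_L(v)` consists of
possible centers for every `v ∈ Λ_Int`, and a discrepancy near the boundary is erased as often as
one in the bulk. -/
theorem LipOn.heatBathStep (hd : 0 < d) (hlam : 0 ≤ lam) (hα : 0 < α) (hβ : 0 < β)
    (hmix : SpatialMixingWith d lam α β) (hL : 0 < L) (hR : 0 ≤ R)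
    (hgap : 1 ≤ (L / radius d) ^ d - spread d α β L R *
      (((L + 2 * radius d) / radius d) ^ d - (L / radius d) ^ d))
    (hΛ : IsCompact Λ) (hτ : MeasurableSet τ)
    (hf : LipOn (innerRegion Λ \ τ) f l) (hfm : Measurable f) (hl : l ≠ ∞) :
    LipOn (innerRegion Λ \ τ) (fun X => ∫⁻ Y, f Y ∂heatBathStep lam Λ τ L X)
      (ENNReal.ofReal (1 - (volume (Metric.cthickening L (innerRegion Λ))).toReal⁻¹) * l) := by
  intro X v _ hX
  have hr := radius_pos d
  set T := Metric.cthickening L (innerRegion Λ) with hT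
  have hTm : MeasurableSet T := Metric.isClosed_cthickening.measurableSet
  have hTb : volume T ≠ ∞ :=
    ((hΛ.isBounded.subset (innerRegion_subset Λ)).cthickening).measure_lt_top.ne
  have hvI : v ∈ innerRegion Λ := (hX.1 v (mem_addPoint.2 (Or.inl rfl))).1
  have hvT : Metric.ball v L ⊆ T := fun x hx =>
    Metric.mem_cthickening_of_dist_le x v L _ hvI (Metric.mem_ball.1 hx).le
  have hc : 0 ≤ spread d α β L R := by unfold spread mixingError; positivity
  have hκ := lintegral_influence_le hd hL hc hgap hTm hTb hvT
  have hm : ∀ X : Config d, ∫⁻ Y, f Y ∂HardSphere.heatBathStep lam Λ τ L X =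
      ∫⁻ x, ∫⁻ Y, f Y ∂HardSphere.resample lam Λ τ L X x ∂(ProbabilityTheory.cond volume T) :=
    fun X => Measure.lintegral_bind
      (measurable_resample lam hΛ.measurableSet hτ L X).aemeasurable hfm.aemeasurable
  have hstep := hf.resample hd hlam hα hβ hmix hL hR hΛ.measurableSet hτ hfm hl hX
  have hmi := (measurable_influence v L (spread d α β L R)).mul_const l
  simp only [hm]
  constructor
  · refine (lintegral_mono fun x => (hstep x).1).trans ?_
    rw [lintegral_add_right _ hmi, lintegral_mul_const _ (measurable_influence _ _ _)]
    gcongr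
  · refine (lintegral_mono fun x => (hstep x).2).trans ?_
    rw [lintegral_add_right _ hmi, lintegral_mul_const _ (measurable_influence _ _ _)]
    gcongr

end Step

/-! ### The choice of the update radius -/

/-- The shell has volume at most `5^d u^(d-1)` in units of `r`; multiplying by `u` avoids the
exponent `d - 1`. In the induction step the error terms have coefficients `2 · 1`, `5^k` and `2 ·
5^k`, which together are at most `5 · 5^k`. -/
theorem add_two_pow_mul_le {u : ℝ} (hu : 1 ≤ u) (d : ℕ) :
    (u + 2) ^ d * u ≤ u ^ d * u + 5 ^ d * u ^ d := by
  induction d with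
  | zero => simp
  | succ k ih =>
    have h5 : (1 : ℝ) ≤ 5 ^ k := one_le_pow₀ (by norm_num)
    have hp : 0 < u ^ k := by positivity
    have h1 := mul_le_mul_of_nonneg_left ih (by linarith : 0 ≤ u + 2)
    have h2 : 5 ^ k * u ^ k ≤ 5 ^ k * u ^ k * u := le_mul_of_one_le_right (by positivity) hu
    have h3 : u ^ k * u ≤ 5 ^ k * (u ^ k * u) := le_mul_of_one_le_left (by positivity) h5
    simp only [pow_succ]
    nlinarith

theorem eventually_pow_mul_exp_le (N : ℕ) {a C : ℝ} (ha : 0 < a) {ε : ℝ} (hε : 0 < ε) :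
    ∀ᶠ w : ℝ in Filter.atTop, C * (w ^ N * Real.exp (-(a * w))) ≤ ε := by
  have h1 : Filter.Tendsto (fun w : ℝ => a * w) Filter.atTop Filter.atTop :=
    Filter.tendsto_id.const_mul_atTop ha
  have h2 := ((Real.tendsto_pow_mul_exp_neg_atTop_nhds_zero N).comp h1).const_mul (C / a ^ N)
  rw [mul_zero] at h2
  filter_upwards [h2.eventually_le_const hε] with w hw
  refine le_trans (le_of_eq ?_) hw
  simp only [Function.comp, mul_pow]
  field_simp

/-- With `u = L / r` and `w = u^(1/(2d))`, take `R = r w`. The near part of `spread` is of order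
`w^d = √u`, the far part a power of `w` times `exp(-α r w)`, so `5^d · spread ≤ u / 2` for large
`u`. Against a shell of volume at most `5^d u^d / u` this loses at most half of the ball volume
`u^d`. -/
theorem exists_updateRadius {d : ℕ} (hd : 0 < d) {α β : ℝ} (hα : 0 < α) (hβ : 0 < β) :
    ∃ L₀ > (0 : ℝ), ∀ L : ℝ, L₀ ≤ L → ∃ R : ℝ, 0 ≤ R ∧
      1 ≤ (L / radius d) ^ d - spread d α β L R *
        (((L + 2 * radius d) / radius d) ^ d - (L / radius d) ^ d) := by
  have hr := radius_pos d
  set ρ := radius d with hρ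
  -- The exponent comes from `u^(2d) = w^(4 d^2)`; the constant collects what is left of `5^d` times
  -- the far part after `u + 1` and `u + 2` are replaced by `2u`.
  obtain ⟨W, hW⟩ := Filter.eventually_atTop.1 (eventually_pow_mul_exp_le (4 * d ^ 2)
    (C := 5 ^ d * 2 * 4 ^ d * β * Real.exp (2 * (α * ρ))) (mul_pos hα hr)
    (by norm_num : (0 : ℝ) < 1 / 4))
  -- The near part needs `8 · 10^d ≤ w^d`, which follows from `w ≥ 80`.
  set w₀ := max W 80 with hw₀
  have hw₀' : 80 ≤ w₀ := le_max_right _ _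
  refine ⟨ρ * w₀ ^ (2 * d), by positivity, fun L hL => ?_⟩
  set u := L / ρ with hu
  have hu₀ : w₀ ^ (2 * d) ≤ u := by
    rw [hu, le_div_iff₀ hr, mul_comm]
    exact hL
  have hunn : 0 ≤ u := le_trans (by positivity) hu₀
  obtain ⟨w, hwnn, hwu⟩ : ∃ w : ℝ, 0 ≤ w ∧ w ^ (2 * d) = u :=
    ⟨u ^ (((2 * d : ℕ) : ℝ)⁻¹), by positivity, Real.rpow_inv_natCast_pow hunn (by omega)⟩
  have hww₀ : w₀ ≤ w := by
    rw [← hwu] at hu₀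
    exact le_of_pow_le_pow_left₀ (by omega) hwnn hu₀
  have hw : 80 ≤ w := hw₀'.trans hww₀
  have hexp := hW w ((le_max_left _ _).trans hww₀)
  have hwu' : w ≤ u := by
    rw [← hwu]
    exact le_self_pow₀ (by linarith) (by omega)
  have hu2 : 2 ≤ u := by linarith
  refine ⟨ρ * w, by positivity, ?_⟩
  have e1 : (L + 2 * ρ) / ρ = u + 2 := by rw [hu]; field_simp
  have e2 : (L + ρ) / ρ = u + 1 := by rw [hu]; field_simp
  have e3 : (ρ * w + 2 * ρ) / ρ = w + 2 := by field_simp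
  have hspread : spread d α β L (ρ * w) = 2 * (w + 2) ^ d +
      2 * (u + 1) ^ d * (β * (u + 2) ^ d * Real.exp (-(α * (ρ * w - 2 * ρ)))) := by
    rw [spread, mixingError, ← hρ, e1, e2, e3]
  have h80 : 8 * 10 ^ d ≤ w ^ d := by
    calc (8 : ℝ) * 10 ^ d ≤ 8 ^ d * 10 ^ d := by
          gcongr
          exact le_self_pow₀ (by norm_num) hd.ne'
      _ = 80 ^ d := by rw [← mul_pow]; norm_num
      _ ≤ w ^ d := by gcongr
  have hnear : 5 ^ d * (2 * (w + 2) ^ d) ≤ u / 4 := by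
    calc (5 : ℝ) ^ d * (2 * (w + 2) ^ d) ≤ 5 ^ d * (2 * (2 * w) ^ d) := by
          gcongr
          linarith
      _ = (8 * 10 ^ d) * w ^ d / 4 := by
          rw [mul_pow, show (10 : ℝ) = 5 * 2 by norm_num, mul_pow]
          ring
      _ ≤ w ^ d * w ^ d / 4 := by gcongr
      _ = u / 4 := by rw [← hwu, two_mul, pow_add]
  have hfar : 5 ^ d * (2 * (u + 1) ^ d * (β * (u + 2) ^ d *
      Real.exp (-(α * (ρ * w - 2 * ρ))))) ≤ u / 4 := by
    calc (5 : ℝ) ^ d * (2 * (u + 1) ^ d * (β * (u + 2) ^ d *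
        Real.exp (-(α * (ρ * w - 2 * ρ)))))
        ≤ 5 ^ d * (2 * (2 * u) ^ d * (β * (2 * u) ^ d *
          Real.exp (-(α * (ρ * w - 2 * ρ))))) := by
          gcongr <;> linarith
      _ = 5 ^ d * 2 * 4 ^ d * β * Real.exp (2 * (α * ρ)) *
          (w ^ (4 * d ^ 2) * Real.exp (-(α * ρ * w))) := by
          have h1 : -(α * (ρ * w - 2 * ρ)) = 2 * (α * ρ) + -(α * ρ * w) := by ring
          have h2 : w ^ (4 * d ^ 2) = u ^ d * u ^ d := by
            rw [← hwu, ← pow_mul, ← pow_add]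
            congr 1
            ring
          rw [h1, Real.exp_add, h2, mul_pow, show (4 : ℝ) = 2 * 2 by norm_num, mul_pow]
          ring
      _ ≤ 1 / 4 := hexp
      _ ≤ u / 4 := by linarith
  have hS : 5 ^ d * spread d α β L (ρ * w) ≤ u / 2 := by
    rw [hspread, mul_add]
    linarith
  have hSnn : 0 ≤ spread d α β L (ρ * w) := by
    rw [hspread]
    positivity
  rw [e1]
  have hshell : (u + 2) ^ d - u ^ d ≤ 5 ^ d * u ^ d / u := by
    rw [le_div_iff₀ (by linarith)]
    linarith [add_two_pow_mul_le (by linarith : 1 ≤ u) d]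
  have hprod : spread d α β L (ρ * w) * ((u + 2) ^ d - u ^ d) ≤ u ^ d / 2 := by
    calc spread d α β L (ρ * w) * ((u + 2) ^ d - u ^ d)
        ≤ spread d α β L (ρ * w) * (5 ^ d * u ^ d / u) := by gcongr
      _ = 5 ^ d * spread d α β L (ρ * w) * (u ^ d / u) := by ring
      _ ≤ u / 2 * (u ^ d / u) := by gcongr
      _ = u ^ d / 2 := by field_simp
  have hud : 2 ≤ u ^ d := hu2.trans (le_self_pow₀ (by linarith) hd.ne')
  linarith

/-! ### Temporal mixing -/

theorem abs_toReal_sub_toReal_le {a b c : ℝ≥0∞} (hc : c ≠ ∞) (hab : a ≤ b + c) (hba : b ≤ a + c) :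
    |a.toReal - b.toReal| ≤ c.toReal := by
  by_cases ha : a = ∞
  · have hb : b = ∞ := by
      by_contra hb
      exact ENNReal.add_ne_top.2 ⟨hb, hc⟩ (top_le_iff.1 (ha ▸ hab))
    simp [ha, hb]
  · have hb : b ≠ ∞ := ne_top_of_le_ne_top (ENNReal.add_ne_top.2 ⟨ha, hc⟩) hba
    have h1 := ENNReal.toReal_mono (ENNReal.add_ne_top.2 ⟨hb, hc⟩) hab
    have h2 := ENNReal.toReal_mono (ENNReal.add_ne_top.2 ⟨ha, hc⟩) hba
    rw [ENNReal.toReal_add hb hc] at h1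
    rw [ENNReal.toReal_add ha hc] at h2
    exact abs_le.2 ⟨by linarith, by linarith⟩

section Mixing

variable {d : ℕ} {lam α β L R : ℝ} {Λ τ : Set (Space d)}

/-- Averages of an observable under two laws on configurations in `Λ` differ by at most twice the
volume of `Λ` times the largest increment of the observable. -/
theorem LipOn.lintegral_le (hd : 0 < d) {f : Config d → ℝ≥0∞} {l : ℝ≥0∞}
    (hf : LipOn (innerRegion Λ \ τ) f l) {p q : Measure (Config d)} [IsProbabilityMeasure p]
    [IsProbabilityMeasure q] (hp : ∀ᵐ X ∂p, X ∈ configs Λ τ) (hq : ∀ᵐ X ∂q, X ∈ configs Λ τ) :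
    ∫⁻ X, f X ∂p ≤ ∫⁻ X, f X ∂q + 2 * volume Λ * l := by
  have hbd : ∀ X ∈ configs Λ τ,
      f ⟨∅⟩ ≤ f X + volume Λ * l ∧ f X ≤ f ⟨∅⟩ + volume Λ * l := by
    intro X hX
    rw [configs_eq] at hX
    refine hf.of_subset (s := X.centers) ?_ hX
      (hX.2.card_le_volume hd fun z hz => mem_innerRegion.1 (hX.1 z hz).1)
    ext y
    simp [Config.union]
  calc ∫⁻ X, f X ∂p ≤ ∫⁻ _, f ⟨∅⟩ + volume Λ * l ∂p := by
        refine lintegral_mono_ae ?_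
        filter_upwards [hp] with X hX using (hbd X hX).2
    _ = ∫⁻ _, f ⟨∅⟩ ∂q + volume Λ * l := by
        rw [lintegral_const, lintegral_const, measure_univ, measure_univ, mul_one, mul_one]
    _ ≤ ∫⁻ X, f X + volume Λ * l ∂q + volume Λ * l := by
        gcongr ?_ + _
        refine lintegral_mono_ae ?_
        filter_upwards [hq] with X hX using (hbd X hX).1
    _ = _ := by
        rw [lintegral_add_const]
        ring

/-- The probability of an event `S` after `t` steps is the initial average of the observable `X ↦
K^t(X, S)`, with `K` the transition kernel, so small increments of these observables, uniformly in
`S`, bound the total variation distance. -/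
theorem tvDist_lawAfter_le (hd : 0 < d) (hΛ : IsCompact Λ) (hτ : MeasurableSet τ) {t : ℕ}
    {l : ℝ≥0∞} (hl : l ≠ ∞)
    (hf : ∀ S : Set (Config d), MeasurableSet S → LipOn (innerRegion Λ \ τ)
      (fun X => (heatBath lam hΛ.measurableSet hτ L ^ t : Kernel (Config d) (Config d)) X S) l)
    {p q : Measure (Config d)} [IsProbabilityMeasure p]
    [IsProbabilityMeasure q] (hp : ∀ᵐ X ∂p, X ∈ configs Λ τ) (hq : ∀ᵐ X ∂q, X ∈ configs Λ τ) :
    tvDist (lawAfter lam hΛ.measurableSet hτ L p t) (lawAfter lam hΛ.measurableSet hτ L q t) ≤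
      (2 * volume Λ * l).toReal := by
  have hc : 2 * volume Λ * l ≠ ∞ :=
    ENNReal.mul_ne_top (ENNReal.mul_ne_top (by simp) hΛ.measure_lt_top.ne) hl
  refine Real.iSup_le (fun S => ?_) ENNReal.toReal_nonneg
  refine abs_toReal_sub_toReal_le hc ?_ ?_ <;>
    rw [lawAfter, lawAfter, Measure.bind_apply S.2 (Kernel.aemeasurable _),
      Measure.bind_apply S.2 (Kernel.aemeasurable _)]
  exacts [(hf S S.2).lintegral_le hd hp hq, (hf S S.2).lintegral_le hd hq hp]

theorem lipOn_heatBath_pow (hd : 0 < d) (hlam : 0 ≤ lam) (hα : 0 < α) (hβ : 0 < β)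
    (hmix : SpatialMixingWith d lam α β) (hL : 0 < L) (hR : 0 ≤ R)
    (hgap : 1 ≤ (L / radius d) ^ d - spread d α β L R *
      (((L + 2 * radius d) / radius d) ^ d - (L / radius d) ^ d))
    (hΛ : IsCompact Λ) (hτ : MeasurableSet τ) (hne : (innerRegion Λ).Nonempty)
    {S : Set (Config d)} (hS : MeasurableSet S) (t : ℕ) :
    LipOn (innerRegion Λ \ τ)
      (fun X => (heatBath lam hΛ.measurableSet hτ L ^ t : Kernel (Config d) (Config d)) X S)
      (ENNReal.ofReal (1 - (volume (Metric.cthickening L (innerRegion Λ))).toReal⁻¹) ^ t) := by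
  induction t with
  | zero =>
    rw [pow_zero, pow_zero]
    refine LipOn.of_le_one _ fun X => ?_
    change Kernel.id X S ≤ 1
    rw [Kernel.id_apply]
    exact prob_le_one
  | succ t ih =>
    have h := ih.heatBathStep hd hlam hα hβ hmix hL hR hgap hΛ hτ (Kernel.measurable_coe _ hS)
      (ENNReal.pow_ne_top ENNReal.ofReal_ne_top)
    rw [pow_succ' (ENNReal.ofReal _)]
    convert h using 2 with X
    -- The new step is split off at the start of the trajectory, so that `K^(t+1)(·, S)` is the
    -- one-step average of `K^t(·, S)`.
    rw [pow_succ]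
    change ((heatBath lam hΛ.measurableSet hτ L ^ t) ∘ₖ heatBath lam hΛ.measurableSet hτ L) X S = _
    rw [Kernel.comp_apply' _ _ _ hS]
    have : heatBath lam hΛ.measurableSet hτ L X = heatBathStep lam Λ τ L X := by
      rw [heatBath, if_pos hne]
      rfl
    rw [this]

theorem optimalTemporalMixing_of_gap (hd : 0 < d) (hlam : 0 ≤ lam) (hα : 0 < α) (hβ : 0 < β)
    (hmix : SpatialMixingWith d lam α β) (hL : 0 < L) (hR : 0 ≤ R)
    (hgap : 1 ≤ (L / radius d) ^ d - spread d α β L R *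
      (((L + 2 * radius d) / radius d) ^ d - (L / radius d) ^ d)) :
    OptimalTemporalMixing d lam L := by
  have hr := radius_pos d
  set C := ((L + 3 * radius d) / radius d) ^ d with hC
  have hCpos : 0 < C := by positivity
  -- The `2` comes from comparing both initial laws with the empty configuration, the factor `e`
  -- from rounding `s n` down to an integer, and `C` bounds `V / n`.
  refine ⟨2 * Real.exp 1, by positivity, C⁻¹, by positivity, ?_⟩
  intro Λ τ hΛ hτ s hs p q hp hq hpΩ hqΩ
  set n := (volume Λ).toReal with hn
  rcases Set.eq_empty_or_nonempty (innerRegion Λ) with hempty | hne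
  -- No sphere can be added, so every observable has increment `0` and the distance vanishes.
  · have h := tvDist_lawAfter_le (lam := lam) (L := L) (t := ⌊s * n⌋₊) (l := 0) hd hΛ hτ.1
      (by simp) (fun S _ X v _ hX => by
        have := (hX.1 v (mem_addPoint.2 (Or.inl rfl))).1
        simp [hempty] at this) hpΩ hqΩ
    refine h.trans ?_
    rw [mul_zero, ENNReal.toReal_zero]
    positivity
  set T := Metric.cthickening L (innerRegion Λ) with hT
  set V := (volume T).toReal with hV
  have hTb : volume T ≠ ∞ :=
    ((hΛ.isBounded.subset (innerRegion_subset Λ)).cthickening).measure_lt_top.ne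
  have hVC : V ≤ n * C := by
    have h := ENNReal.toReal_mono (ENNReal.mul_ne_top hΛ.measure_lt_top.ne ENNReal.ofReal_ne_top)
      (volume_cthickening_innerRegion_le hd hΛ hL)
    rwa [ENNReal.toReal_mul, ENNReal.toReal_ofReal hCpos.le] at h
  -- The gap condition already forces `|B_L| ≥ 1`, and `T` contains such a ball. This makes `1 -
  -- 1/V` nonnegative and limits the rounding loss below to a factor `e`.
  have hV1 : 1 ≤ V := by
    obtain ⟨v, hv⟩ := hne
    have h : ENNReal.ofReal ((L / radius d) ^ d) ≤ volume T := by
      rw [← volume_ball hd v hL.le]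
      exact measure_mono fun x hx =>
        Metric.mem_cthickening_of_dist_le x v L _ hv (Metric.mem_ball.1 hx).le
    have h1 := (ENNReal.ofReal_le_iff_le_toReal hTb).1 h
    have h2 : (L / radius d) ^ d ≤ ((L + 2 * radius d) / radius d) ^ d := by
      gcongr
      linarith
    have h3 : 0 ≤ spread d α β L R := by unfold spread mixingError; positivity
    have h4 := mul_nonneg h3 (sub_nonneg.2 h2)
    linarith
  have hnn : 0 ≤ n := ENNReal.toReal_nonneg
  set t := ⌊s * n⌋₊ with ht
  refine (tvDist_lawAfter_le (lam := lam) (L := L) (t := t) hd hΛ hτ.1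
    (ENNReal.pow_ne_top ENNReal.ofReal_ne_top) (fun S hS => lipOn_heatBath_pow hd hlam hα hβ hmix
      hL hR hgap hΛ hτ.1 hne hS t) hpΩ hqΩ).trans ?_
  have hq1 : 0 ≤ 1 - V⁻¹ := sub_nonneg.2 (inv_le_one_of_one_le₀ hV1)
  rw [ENNReal.toReal_mul, ENNReal.toReal_mul, ENNReal.toReal_pow, ENNReal.toReal_ofReal hq1,
    ← hn, ENNReal.toReal_ofNat]
  have hpow : (1 - V⁻¹) ^ t ≤ Real.exp 1 * Real.exp (-(C⁻¹ * s)) := by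
    calc (1 - V⁻¹) ^ t ≤ Real.exp (-V⁻¹) ^ t := by
          gcongr
          exact Real.one_sub_le_exp_neg _
      _ = Real.exp (-(t * V⁻¹)) := by rw [← Real.exp_nat_mul, mul_neg]
      _ ≤ Real.exp (1 + -(C⁻¹ * s)) := by
          refine Real.exp_le_exp.2 ?_
          have h1 : s * n - 1 ≤ t := (Nat.sub_one_lt_floor (s * n)).le
          have hVi : 0 < V⁻¹ := by positivity
          have h2 := mul_le_mul_of_nonneg_right h1 hVi.le
          have h3 : V⁻¹ ≤ 1 := inv_le_one_of_one_le₀ hV1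
          have h4 : C⁻¹ ≤ n * V⁻¹ := by
            rw [← div_eq_mul_inv, le_div_iff₀ (by linarith), inv_mul_le_iff₀ hCpos, mul_comm]
            exact hVC
          have h5 := mul_le_mul_of_nonneg_left h4 hs.le
          nlinarith
      _ = _ := Real.exp_add _ _
  calc 2 * n * (1 - V⁻¹) ^ t ≤ 2 * n * (Real.exp 1 * Real.exp (-(C⁻¹ * s))) := by gcongr
    _ = _ := by ring

end Mixing

end HardSphere

end

theorem theorem6 (d : ℕ) (hd : 2 ≤ d) (lam : ℝ) (hlam : 0 < lam)
    (hSSM : HardSphere.StrongSpatialMixing d lam) :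
    ∃ L₀ > (0 : ℝ), ∀ L : ℝ, L₀ ≤ L → HardSphere.OptimalTemporalMixing d lam L := by
  obtain ⟨α, hα, β, hβ, hmix⟩ := hSSM
  have hd0 : 0 < d := by omega
  obtain ⟨L₀, hL₀, h⟩ := HardSphere.exists_updateRadius hd0 hα hβ
  refine ⟨L₀, hL₀, fun L hL => ?_⟩
  obtain ⟨R, hR, hgap⟩ := h L hL
  exact HardSphere.optimalTemporalMixing_of_gap hd0 hlam.le hα hβ hmix (hL₀.trans_le hL) hR hgap
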